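/- **Setting.** Let $d,m\in\mathbb N$, $r>0$, $T>0$, $0<\alpha<\tfrac12$, and write $\mathbb R^d_+=[0,\infty)^d$. For $s<t$ put $$\|f\|_{\alpha,\infty(s,t)}=\sup_{u\in[s,t]}\Big(|f(u)|+\int_s^u\frac{|f(u)-f(v)|}{(u-v)^{\alpha+1}}\,dv\Big),$$ let $W_0^{\alpha,\infty}(s,t;\mathbb R^d_+)$ be the set of measurable $f:[s,t]\to\mathbb R^d_+$ with finite norm, and write $\|f\|_{\alpha,\infty(r)}=\|f\|_{\alpha,\infty(-r,T)}$. Let $W_T^{1-\alpha,\infty}(0,T;\mathbb R^m)$ be the set of measurable $g:[0,T]\to\mathbb R^m$ with $$\sup_{0<s<t<T}\Big(\frac{|g(t)-g(s)|}{(t-s)^{1-\alpha}}+\int_s^t\frac{|g(y)-g(s)|}{(y-s)^{2-\alpha}}\,dy\Big)<\infty,$$ and for such $g$ put $\Lambda_\alpha(g)=\frac1{\Gamma(1-\alpha)}\sup_{0<s<t<T}|(D^{1-\alpha}_{t-}g_{t-})(s)|$, where $g_{t-}(s)=(g(s)-g(t-))\mathbf 1_{(0,t)}(s)$ and $$(D^{\delta}_{t-}h)(s)=\frac{(-1)^{\delta}}{\Gamma(1-\delta)}\Big(\frac{h(s)}{(t-s)^{\delta}}+\delta\int_s^t\frac{h(s)-h(y)}{(y-s)^{\delta+1}}\,dy\Big),\qquad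 (D^{\delta}_{0+}f)(s)=\frac{1}{\Gamma(1-\delta)}\Big(\frac{f(s)}{s^{\delta}}+\delta\int_0^s\frac{f(s)-f(y)}{(s-y)^{\delta+1}}\,dy\Big).$$ The integral against $g$ is the generalized Stieltjes integral, defined for scalar $f,g$ by $\int_0^T f\,dg=(-1)^\alpha\int_0^T (D^\alpha_{0+}f)(s)\,(D^{1-\alpha}_{T-}g_{T-})(s)\,ds$ (with $(-1)^\alpha(-1)^{1-\alpha}=-1$) and $\int_0^tf\,dg=\int_0^Tf\mathbf 1_{(0,t)}\,dg$, and componentwise for matrix-valued $f$ and vector-valued $g$. **Hypotheses.** Let $\beta>\alpha$, $M_0,K_0>0$, $\gamma\in[0,1]$. * (H1) $\sigma:[0,T]\times\mathbb R^d\to\mathbb R^{d\times m}$ is measurable, $|\sigma(t,x)-\sigma(t,y)|\le M_0|x-y|$ and $|\sigma(t,x)-\sigma(s,x)|\le M_0|t-s|^\beta$ for all $x,y\in\mathbb R^d$, $s,t\in[0,T]$. * (H2) $b:[0,T]\times C([-r,T];\mathbb R^d)\to\mathbb R^d$ is measurable, $b(t,f)$ depends only on $f|_{[-r,t]}$ for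 $t>0$, and there are $b_0\in L^{1/\alpha}(0,T)$ and constants $L_N>0$ $(N\ge0)$ such that, for all $t\in[0,T]$, $|b(t,x)-b(t,y)|\le L_N\sup_{-r\le s\le t}|x(s)-y(s)|$ whenever $\|x\|_\infty,\|y\|_\infty\le N$, and $|b(t,x)|\le L_0\sup_{-r\le s\le t}|x(s)|+b_0(t)$ for all $x$. * (H3) $|\sigma(t,x)|\le K_0(1+|x|^\gamma)$ for all $x\in\mathbb R^d$, $t\in[0,T]$. Let $\varphi(\gamma,\alpha)\in[\alpha,2\alpha]$ be $2\alpha$ if $\gamma=1$, any chosen number $>1+\frac{2\alpha-1}{\gamma}$ if $\frac{1-2\alpha}{1-\alpha}\le\gamma<1$, and $\alpha$ if $0\le\gamma<\frac{1-2\alpha}{1-\alpha}$. **Equation.** Let $g\in W_T^{1-\alpha,\infty}(0,T;\mathbb R^m)$ and $\eta\in W_0^{\alpha,\infty}(-r,0;\mathbb R^d_+)$. A solution is a continuous $x\in W_0^{\alpha,\infty}(-r,T;\mathbb R^d_+)$ with $x=\eta$ on $[-r,0]$ and $x(t)=z(t)+y(t)$ for $t\in(0,T]$, where $$z(t)=\eta(0)+\int_0^t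 b(s,x)\,ds+\int_0^t\sigma(s,x(s-r))\,dg_s,\qquad y^i(t)=\max_{s\in[0,t]}(z^i(s))^-,\quad i=1,\dots,d.$$ **Lemma.** Assume (H1), (H2) and (H3). Then every solution $x$ of this equation satisfies $$\|x\|_{\alpha,\infty(r)}\le d_3\big(\|\eta\|_{\alpha,\infty(-r,0)}+\Lambda_\alpha(g)+1\big)\exp\Big(T\big(d_1+d_2\,\Lambda_\alpha(g)^{1/(1-\varphi(\gamma,\alpha))}\big)\Big).$$ Here $d_1,d_2>0$ depend only on $d,m,r,T,\alpha,M_0,K_0,L_0$ and an upper bound for $\|b_0\|_{L^{1/\alpha}(0,T)}$ (not on $\beta$, $\gamma$ or $\varphi$), and $d_3>0$ depends only on these and on $\beta,\gamma,\varphi(\gamma,\alpha)$. In particular none of them depends on $g$, $\eta$ or $x$. -/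

import Mathlib

open MeasureTheory Set
open scoped ENNReal

namespace DelayReflection

noncomputable section

/-- The Euclidean space `ℝⁿ`. -/
abbrev Eu (n : ℕ) : Type := EuclideanSpace ℝ (Fin n)

/-- Real `d × m` matrices with the Euclidean (Frobenius) norm. -/
abbrev Mat (d m : ℕ) : Type := EuclideanSpace ℝ (Fin d × Fin m)

/-! ### Function spaces -/

/-- `‖f‖_{α,∞(s,t)} = sup_{u ∈ [s,t]} (|f(u)| + ∫_s^u |f(u) - f(v)| / (u - v)^{α+1} dv)`,
as an element of `[0,∞]`. -/
def normAlphaInf {n : ℕ} (α s t : ℝ) (f : ℝ → Eu n) : ℝ≥0∞ :=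
  ⨆ u ∈ Icc s t, (ENNReal.ofReal ‖f u‖ +
    ∫⁻ v in Ioo s u, ENNReal.ofReal (‖f u - f v‖ / (u - v) ^ (α + 1)))

/-- `f ∈ W_0^{α,∞}(s,t;ℝⁿ_+)`: `f` is measurable on `[s,t]`, has finite norm, and takes values in
the closed positive orthant. Only the values of `f` on `[s,t]` matter. -/
structure MemWPos {n : ℕ} (α s t : ℝ) (f : ℝ → Eu n) : Prop where
  measurable : Measurable ((Icc s t).domRestrict f)
  norm_lt_top : normAlphaInf α s t f < ∞
  nonneg : ∀ u ∈ Icc s t, ∀ i, 0 ≤ f u i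

/-- `‖g‖_{1-α,∞,T} = sup_{0<s<t<T} (|g(t)-g(s)|/(t-s)^{1-α} + ∫_s^t |g(y)-g(s)|/(y-s)^{2-α} dy)`,
as an element of `[0,∞]`. -/
def normDriver {n : ℕ} (α T : ℝ) (g : ℝ → Eu n) : ℝ≥0∞ :=
  ⨆ (s : ℝ) (t : ℝ) (_ : 0 < s ∧ s < t ∧ t < T),
    (ENNReal.ofReal (‖g t - g s‖ / (t - s) ^ (1 - α)) +
      ∫⁻ y in Ioo s t, ENNReal.ofReal (‖g y - g s‖ / (y - s) ^ (2 - α)))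

/-- `g ∈ W_T^{1-α,∞}(0,T;ℝⁿ)`. -/
structure MemDriver {n : ℕ} (α T : ℝ) (g : ℝ → Eu n) : Prop where
  measurable : Measurable ((Icc 0 T).domRestrict g)
  norm_lt_top : normDriver α T g < ∞

/-! ### Fractional Weyl derivatives and the generalized Stieltjes integral -/

/-- The left-sided Weyl derivative
`(D^α_{a+} f)(s) = Γ(1-α)⁻¹ (f(s)/(s-a)^α + α ∫_a^s (f(s)-f(y))/(s-y)^{α+1} dy)`, for `s > a`. -/
def weylLeft (α a : ℝ) (f : ℝ → ℝ) (s : ℝ) : ℝ :=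
  (1 / Real.Gamma (1 - α)) *
    (f s / (s - a) ^ α + α * ∫ y in a..s, (f s - f y) / (s - y) ^ (α + 1))

/-- The right-sided Weyl derivative of order `δ`, without the conventional unimodular factor
`(-1)^δ`:
`(-1)^{-δ} (D^δ_{b-} h)(s) = Γ(1-δ)⁻¹ (h(s)/(b-s)^δ + δ ∫_s^b (h(s)-h(y))/(y-s)^{δ+1} dy)`,
for `s < b`. -/
def weylRight {F : Type*} [NormedAddCommGroup F] [NormedSpace ℝ F]
    (δ b : ℝ) (h : ℝ → F) (s : ℝ) : F :=
  (1 / Real.Gamma (1 - δ)) •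
    ((1 / (b - s) ^ δ) • h s + δ • ∫ y in s..b, (1 / (y - s) ^ (δ + 1)) • (h s - h y))

/-- `g_{t-}(s) = (g(s) - g(t-)) 1_{(0,t)}(s)`. -/
def shiftLeft {F : Type*} [NormedAddCommGroup F] (g : ℝ → F) (t : ℝ) : ℝ → F :=
  (Ioo 0 t).indicator fun s => g s - Function.leftLim g t

/-- `Λ_α(g) = Γ(1-α)⁻¹ sup_{0<s<t<T} |(D^{1-α}_{t-} g_{t-})(s)|`. The supremum is taken in `[0,∞]`;
it is finite for `g ∈ W_T^{1-α,∞}(0,T)`. -/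
def Lam {n : ℕ} (α T : ℝ) (g : ℝ → Eu n) : ℝ :=
  (1 / Real.Gamma (1 - α)) *
    (⨆ (s : ℝ) (t : ℝ) (_ : 0 < s ∧ s < t ∧ t < T),
      ENNReal.ofReal ‖weylRight (1 - α) t (shiftLeft g t) s‖).toReal

/-- The generalized Stieltjes integral
`∫_0^T f dg = (-1)^α ∫_0^T (D^α_{0+} f)(s) (D^{1-α}_{T-} g_{T-})(s) ds`.
The two unimodular factors multiply to `(-1)^α (-1)^{1-α} = -1`. -/
def stieltjes (α T : ℝ) (f g : ℝ → ℝ) : ℝ :=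
  -∫ s in (0)..T, weylLeft α 0 f s * weylRight (1 - α) T (shiftLeft g T) s

/-- `∫_0^t f dg = ∫_0^T f 1_{(0,t)} dg` for a `d × m` matrix valued `f` and an `ℝᵐ`-valued `g`:
the `i`-th coordinate is `∑_j ∫_0^t f^{ij} dg^j`. -/
def stieltjesVec {d m : ℕ} (α T : ℝ) (f : ℝ → Mat d m) (g : ℝ → Eu m) (t : ℝ) : Eu d :=
  WithLp.toLp 2 fun i : Fin d =>
    ∑ j : Fin m, stieltjes α T ((Ioo 0 t).indicator fun s => f s (i, j)) fun s => g s j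

/-! ### Hypotheses on the coefficients -/

/-- Continuous paths `[-r,T] → ℝᵈ`, with the supremum norm. -/
abbrev CPath (d : ℕ) (r T : ℝ) : Type := C(Icc (-r) T, Eu d)

/-- `sup_{-r ≤ s ≤ t} |x(s)|`. -/
def supUpTo {d : ℕ} {r T : ℝ} (x : CPath d r T) (t : ℝ) : ℝ :=
  ⨆ s : {s : Icc (-r) T // (s : ℝ) ≤ t}, ‖x s.1‖

/-- Hypothesis (H1): `σ` is measurable, Lipschitz in space and `β`-Hölder in time. -/
structure H1 {d m : ℕ} (T β M₀ : ℝ) (σ : ℝ → Eu d → Mat d m) : Prop where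
  measurable : Measurable fun p : Icc (0 : ℝ) T × Eu d => σ p.1 p.2
  lipschitz : ∀ t ∈ Icc 0 T, ∀ x y, ‖σ t x - σ t y‖ ≤ M₀ * ‖x - y‖
  holder : ∀ x, ∀ t ∈ Icc 0 T, ∀ s ∈ Icc 0 T, ‖σ t x - σ s x‖ ≤ M₀ * |t - s| ^ β

/-- Hypothesis (H2) with integrability exponent `ρ`: the drift `b` is Borel measurable, non
anticipating, locally Lipschitz with constants `L N`, and has linear growth. -/
structure H2 {d : ℕ} (r T ρ : ℝ) (b : ℝ → CPath d r T → Eu d) (L : ℝ → ℝ) (b₀ : ℝ → ℝ) :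
    Prop where
  measurable : @Measurable (Icc (0 : ℝ) T × CPath d r T) (Eu d)
    (@Prod.instMeasurableSpace _ _ inferInstance (borel (CPath d r T))) inferInstance
    fun p => b p.1 p.2
  causal : ∀ t ∈ Ioc 0 T, ∀ x y : CPath d r T,
    (∀ s : Icc (-r) T, (s : ℝ) ≤ t → x s = y s) → b t x = b t y
  memLp : MemLp b₀ (ENNReal.ofReal ρ) (volume.restrict (Ioc 0 T))
  const_pos : ∀ N, 0 ≤ N → 0 < L N
  lipschitz : ∀ N, 0 ≤ N → ∀ x y : CPath d r T, ‖x‖ ≤ N → ‖y‖ ≤ N → ∀ t ∈ Icc 0 T,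
    ‖b t x - b t y‖ ≤ L N * supUpTo (x - y) t
  growth : ∀ x : CPath d r T, ∀ t ∈ Icc 0 T, ‖b t x‖ ≤ L 0 * supUpTo x t + b₀ t

/-- Hypothesis (H3): `|σ(t,x)| ≤ K₀ (1 + |x|^γ)`. -/
def H3 {d m : ℕ} (T γ K₀ : ℝ) (σ : ℝ → Eu d → Mat d m) : Prop :=
  ∀ x, ∀ t ∈ Icc 0 T, ‖σ t x‖ ≤ K₀ * (1 + ‖x‖ ^ γ)

/-- `φ` is an admissible value of the exponent `φ(γ,α) ∈ [α,2α]`: it is `2α` for `γ = 1`, a number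
`> 1 + (2α-1)/γ` for `(1-2α)/(1-α) ≤ γ < 1`, and `α` for `γ < (1-2α)/(1-α)`. -/
structure IsExponent (α γ φ : ℝ) : Prop where
  mem : φ ∈ Icc α (2 * α)
  of_eq_one : γ = 1 → φ = 2 * α
  of_mid : (1 - 2 * α) / (1 - α) ≤ γ → γ < 1 → 1 + (2 * α - 1) / γ < φ
  of_low : γ < (1 - 2 * α) / (1 - α) → φ = α

/-! ### The reflected delay equation -/

/-- The restriction to `[-r,T]` of a function continuous there, as a continuous path. -/
def pathOf {d : ℕ} {r T : ℝ} (x : ℝ → Eu d) (hx : ContinuousOn x (Icc (-r) T)) : CPath d r T :=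
  ⟨(Icc (-r) T).domRestrict x, hx.domRestrict⟩

/-- `z(t) = η(0) + ∫_0^t b(s,x) ds + ∫_0^t σ(s,x(s-r)) dg_s`. -/
def reflector {d m : ℕ} (α : ℝ) {r T : ℝ} (b : ℝ → CPath d r T → Eu d) (σ : ℝ → Eu d → Mat d m)
    (g : ℝ → Eu m) (η x : ℝ → Eu d) (hx : ContinuousOn x (Icc (-r) T)) (t : ℝ) : Eu d :=
  η 0 + (∫ s in (0)..t, b s (pathOf x hx)) + stieltjesVec α T (fun s => σ s (x (s - r))) g t

/-- `y^i(t) = max_{s ∈ [0,t]} (z^i(s))^-`. -/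
def regulator {d : ℕ} (z : ℝ → Eu d) (t : ℝ) : Eu d :=
  WithLp.toLp 2 fun i : Fin d => ⨆ s : Icc (0 : ℝ) t, (z s i)⁻

/-- `x` is a solution on `[-r,T]` of the reflected delay equation with initial path `η`: a continuous
function in `W_0^{α,∞}(-r,T;ℝᵈ_+)` such that `x = z + y` on `(0,T]` and `x = η` on `[-r,0]`. -/
structure IsSolution {d m : ℕ} (α r T : ℝ) (b : ℝ → CPath d r T → Eu d)
    (σ : ℝ → Eu d → Mat d m) (g : ℝ → Eu m) (η x : ℝ → Eu d) : Prop where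
  memW : MemWPos α (-r) T x
  continuousOn : ContinuousOn x (Icc (-r) T)
  equation : ∀ t ∈ Ioc 0 T, x t = reflector α b σ g η x continuousOn t +
    regulator (reflector α b σ g η x continuousOn) t
  initial : ∀ t ∈ Icc (-r) 0, x t = η t

end

end DelayReflection

open DelayReflection

namespace DelayReflection

open Filter Topology

/-! ### Power integrals and a Gronwall inequality -/

/-! The delay makes the equation explicit in its rough part. For times up to `τ + r` the integrand
`σ(s, x(s - r))` sees the path only up to `τ`, so the Stieltjes integral on that window is
controlled by Λ and the norm of `x` on `[-r, τ]`, with no fixed point to solve. It is (1-α)-Hölder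
in its upper limit with coefficient of order Λ (1 + ‖x‖_τ) (`norm_stieltjesVec_sub_le`): the
difference of two such integrals pairs the Weyl derivative of `f 1_{[s,t)}`, which has an explicit
integrable majorant, with a driver derivative bounded by Γ(1-α) Λ.

The drift still depends on the current path, but only through its running supremum, up to an L^{1/α}
term that contributes another (1-α)-Hölder increment. The reflection term costs a factor `1 + d`:
the increments of a running maximum of negative parts are bounded by the oscillation of `z`. A
Gronwall argument bounds the supremum (`IsSolution.norm_le`); that bound makes `x` (1-α)-Hölder on
positive times, hence bounds its fractional norm since 1 - α > α (`IsSolution.normAlphaInf_le`).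

One delay step therefore gives 1 + ‖x‖_{τ+r} ≤ C (1 + Λ)(1 + ‖x‖_τ)
(`IsSolution.normAlphaInf_step`). With N = ⌈T/r⌉ steps the norm is at most C^N (1 + Λ)^N (1 + ‖η‖),
polynomial in Λ. Since x^N / N! ≤ e^x and Λ ≤ 1 + Λ^p for p = 1/(1-φ) ≥ 1, this polynomial is
absorbed into the exponential with the universal values d₁ = 2 and d₂ = 1; everything else,
including the dependence on β, goes into d₃. The exponent γ enters only through |x|^γ ≤ 1 + |x|, and
φ only through p ≥ 1. -/

theorem intervalIntegrable_sub_rpow {a b u q : ℝ} (hab : a ≤ b)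
    (h : -1 < q ∨ q ≠ -1 ∧ b < u) :
    IntervalIntegrable (fun v => (u - v) ^ q) volume a b := by
  have h1 : IntervalIntegrable (fun v : ℝ => v ^ q) volume (u - a) (u - b) := by
    rcases h with h | h
    · exact intervalIntegral.intervalIntegrable_rpow' h
    · refine intervalIntegral.intervalIntegrable_rpow (Or.inr ?_)
      rw [uIcc_of_ge (by linarith)]
      exact fun h0 => absurd h0.1 (by linarith [h.2])
  simpa using h1.comp_sub_left u

theorem integral_sub_rpow {a b u q : ℝ} (hab : a ≤ b)
    (h : -1 < q ∨ q ≠ -1 ∧ b < u) :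
    ∫ v in a..b, (u - v) ^ q = ((u - a) ^ (q + 1) - (u - b) ^ (q + 1)) / (q + 1) := by
  rw [intervalIntegral.integral_comp_sub_left (fun v => v ^ q), integral_rpow]
  rcases h with h | h
  · exact Or.inl h
  · refine Or.inr ⟨h.1, ?_⟩
    rw [uIcc_of_le (by linarith)]
    exact fun h0 => absurd h0.1 (by linarith [h.2])

theorem lintegral_Ioc_ofReal_eq {f : ℝ → ℝ} {a b : ℝ} (hab : a ≤ b)
    (hf : IntervalIntegrable f volume a b) (h0 : ∀ v ∈ Ioc a b, 0 ≤ f v) :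
    ∫⁻ v in Ioc a b, ENNReal.ofReal (f v) = ENNReal.ofReal (∫ v in a..b, f v) := by
  rw [intervalIntegral.integral_of_le hab, ofReal_integral_eq_lintegral_ofReal]
  · exact (intervalIntegrable_iff_integrableOn_Ioc_of_le hab).1 hf
  · exact (ae_restrict_mem measurableSet_Ioc).mono h0

theorem lintegral_Ioc_sub_rpow {a b u q : ℝ} (hab : a ≤ b) (hbu : b ≤ u)
    (h : -1 < q ∨ q ≠ -1 ∧ b < u) :
    ∫⁻ v in Ioc a b, ENNReal.ofReal ((u - v) ^ q) =
      ENNReal.ofReal (((u - a) ^ (q + 1) - (u - b) ^ (q + 1)) / (q + 1)) := by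
  rw [lintegral_Ioc_ofReal_eq hab (intervalIntegrable_sub_rpow hab h)
    fun v hv => Real.rpow_nonneg (by linarith [hv.2]) _, integral_sub_rpow hab h]

theorem lintegral_Ioo_sub_rpow {a u q : ℝ} (hau : a ≤ u) (h : -1 < q) :
    ∫⁻ v in Ioo a u, ENNReal.ofReal ((u - v) ^ q) =
      ENNReal.ofReal ((u - a) ^ (q + 1) / (q + 1)) := by
  rw [setLIntegral_congr Ioo_ae_eq_Ioc, lintegral_Ioc_sub_rpow hau le_rfl (Or.inl h), sub_self,
    Real.zero_rpow (by linarith), sub_zero]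

theorem intervalIntegrable_rpow_sub {a b s q : ℝ} (h : -1 < q) :
    IntervalIntegrable (fun v => (v - s) ^ q) volume a b := by
  simpa using (intervalIntegral.intervalIntegrable_rpow' h : IntervalIntegrable (fun v : ℝ => v ^ q)
    volume (a - s) (b - s)).comp_sub_right s

theorem integral_rpow_sub {a b s q : ℝ} (h : -1 < q) :
    ∫ v in a..b, (v - s) ^ q = ((b - s) ^ (q + 1) - (a - s) ^ (q + 1)) / (q + 1) := by
  rw [intervalIntegral.integral_comp_sub_right (fun v => v ^ q), integral_rpow (Or.inl h)]

/-- A bounded `S` with `S ≤ a + c ∫₀ S` grows at most exponentially. -/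
theorem le_exp_of_le_add_integral {S : ℝ → ℝ} {a c τ B : ℝ} (ha : 0 ≤ a) (hc : 0 < c)
    (hS : IntervalIntegrable S volume 0 τ) (hB : ∀ t ∈ Icc 0 τ, S t ≤ B)
    (h : ∀ t ∈ Icc 0 τ, S t ≤ a + c * ∫ u in (0)..t, S u) :
    ∀ t ∈ Icc 0 τ, S t ≤ 2 * a * Real.exp (2 * c * t) := by
  intro t ht
  have hτ : 0 ≤ τ := ht.1.trans ht.2
  -- Exponentially weighted supremum: at rate 2c the integral term reproduces only half of the
  -- weighted supremum M, so M ≤ a + M/2 and M ≤ 2a. The a priori bound `B` makes M finite.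
  set f : ℝ → ℝ := fun t => Real.exp (-(2 * c * t)) * S t with hf
  have hbdd : BddAbove (f '' Icc 0 τ) := by
    refine ⟨|B|, ?_⟩
    rintro _ ⟨u, hu, rfl⟩
    have h1 : Real.exp (-(2 * c * u)) ≤ 1 :=
      Real.exp_le_one_iff.2 (by have := mul_nonneg hc.le hu.1; linarith)
    calc f u ≤ Real.exp (-(2 * c * u)) * |B| :=
          mul_le_mul_of_nonneg_left ((hB u hu).trans (le_abs_self B)) (Real.exp_pos _).le
      _ ≤ 1 * |B| := mul_le_mul_of_nonneg_right h1 (abs_nonneg B)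
      _ = |B| := one_mul _
  set M := max 0 (sSup (f '' Icc 0 τ)) with hM
  have hM0 : 0 ≤ M := le_max_left _ _
  have hSM : ∀ u ∈ Icc 0 τ, S u ≤ M * Real.exp (2 * c * u) := by
    intro u hu
    have h1 : f u ≤ M := (le_csSup hbdd (mem_image_of_mem f hu)).trans (le_max_right _ _)
    have h2 : S u = f u * Real.exp (2 * c * u) := by
      simp only [hf]
      rw [mul_right_comm, ← Real.exp_add]
      simp
    rw [h2]
    exact mul_le_mul_of_nonneg_right h1 (Real.exp_pos _).le
  have key : ∀ u ∈ Icc 0 τ, f u ≤ a + M / 2 := by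
    intro u hu
    have hder : ∀ v, HasDerivAt (fun v => M / (2 * c) * Real.exp (2 * c * v))
        (M * Real.exp (2 * c * v)) v := by
      intro v
      refine ((((hasDerivAt_id v).const_mul (2 * c)).exp).const_mul (M / (2 * c))).congr_deriv ?_
      simp only [id]
      field_simp
    have hcont : Continuous fun v => M * Real.exp (2 * c * v) := by fun_prop
    have hint : ∫ v in (0)..u, M * Real.exp (2 * c * v) =
        M / (2 * c) * Real.exp (2 * c * u) - M / (2 * c) := by
      rw [intervalIntegral.integral_eq_sub_of_hasDerivAt (fun v _ => hder v)
        (hcont.intervalIntegrable _ _)]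
      simp
    have hle : ∫ v in (0)..u, S v ≤ ∫ v in (0)..u, M * Real.exp (2 * c * v) := by
      refine intervalIntegral.integral_mono_on hu.1 (hS.mono_set ?_) (hcont.intervalIntegrable _ _)
        fun v hv => hSM v ⟨hv.1, hv.2.trans hu.2⟩
      rw [uIcc_of_le hu.1, uIcc_of_le hτ]
      exact Icc_subset_Icc_right hu.2
    have hSu : S u ≤ a + M / 2 * Real.exp (2 * c * u) := by
      have h1 : c * (M / (2 * c) * Real.exp (2 * c * u) - M / (2 * c)) ≤
          M / 2 * Real.exp (2 * c * u) := by
        have : c * (M / (2 * c) * Real.exp (2 * c * u) - M / (2 * c)) =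
          M / 2 * Real.exp (2 * c * u) - M / 2 := by field_simp
        linarith
      have h2 := mul_le_mul_of_nonneg_left (hle.trans_eq hint) hc.le
      linarith [h u hu]
    have h1 : Real.exp (-(2 * c * u)) ≤ 1 :=
      Real.exp_le_one_iff.2 (by have := mul_nonneg hc.le hu.1; linarith)
    calc f u ≤ Real.exp (-(2 * c * u)) * (a + M / 2 * Real.exp (2 * c * u)) :=
          mul_le_mul_of_nonneg_left hSu (Real.exp_pos _).le
      _ = Real.exp (-(2 * c * u)) * a +
          M / 2 * (Real.exp (-(2 * c * u)) * Real.exp (2 * c * u)) := by ring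
      _ = Real.exp (-(2 * c * u)) * a + M / 2 := by rw [← Real.exp_add]; simp
      _ ≤ a + M / 2 := by nlinarith
  have hM2 : M ≤ 2 * a := by
    have : M ≤ a + M / 2 := by
      refine max_le (by positivity) (csSup_le ⟨_, mem_image_of_mem f ht⟩ ?_)
      rintro _ ⟨u, hu, rfl⟩
      exact key u hu
    linarith
  exact (hSM t ht).trans (mul_le_mul_of_nonneg_right hM2 (Real.exp_pos _).le)

/-! ### Measurability -/

/-- The data are measurable only as functions on a closed interval; extension by zero turns them
into globally measurable functions, as parametric integration requires. -/
theorem measurable_indicator_of_domRestrict {β : Type*} [MeasurableSpace β] [Zero β] {f : ℝ → β}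
    {s t : Set ℝ} (hf : Measurable (s.domRestrict f)) (hts : t ⊆ s) (ht : MeasurableSet t) :
    Measurable (t.indicator f) := by
  refine measurable_of_restrict_of_restrict_compl ht ?_ ?_
  · have h : t.domRestrict (t.indicator f) = s.domRestrict f ∘ inclusion hts := by
      ext x
      simp [domRestrict_apply, x.2]
    rw [h]
    exact hf.comp (measurable_inclusion hts)
  · have h : tᶜ.domRestrict (t.indicator f) = fun _ => 0 := by
      ext x
      simpa [domRestrict_apply] using fun h : (x : ℝ) ∈ t => absurd h x.2
    rw [h]
    exact measurable_const

/-- The moving limits are absorbed into the indicator of a measurable subset of the plane, so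
measurability of integrals over a fixed space applies; an oriented integral is a difference of two
of these. -/
theorem measurable_intervalIntegral {k : ℝ → ℝ → ℝ} (hk : Measurable (Function.uncurry k))
    {a b : ℝ → ℝ} (ha : Measurable a) (hb : Measurable b) :
    Measurable fun s => ∫ y in a s..b s, k s y := by
  have key : ∀ {a b : ℝ → ℝ}, Measurable a → Measurable b →
      Measurable fun s => ∫ y in Ioc (a s) (b s), k s y := by
    intro a b ha hb
    have hS : MeasurableSet {p : ℝ × ℝ | a p.1 < p.2 ∧ p.2 ≤ b p.1} :=
      (measurableSet_lt (ha.comp measurable_fst) measurable_snd).inter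
        (measurableSet_le measurable_snd (hb.comp measurable_fst))
    have h := ((hk.indicator hS).stronglyMeasurable.integral_prod_right' (ν := volume)).measurable
    convert h using 2 with s
    rw [← integral_indicator measurableSet_Ioc]
    rfl
  exact (key ha hb).sub (key hb ha)

/-! ### Drivers -/

section Driver

variable {n : ℕ} {α T : ℝ} {g : ℝ → Eu n}

theorem MemDriver.le_normDriver {s t : ℝ} (hs : 0 < s) (hst : s < t) (htT : t < T) :
    ENNReal.ofReal (‖g t - g s‖ / (t - s) ^ (1 - α)) +
      ∫⁻ y in Ioo s t, ENNReal.ofReal (‖g y - g s‖ / (y - s) ^ (2 - α)) ≤ normDriver α T g :=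
  le_iSup_of_le s (le_iSup_of_le t (le_iSup_of_le ⟨hs, hst, htT⟩ le_rfl))

theorem MemDriver.norm_sub_le (hg : MemDriver α T g) {s t : ℝ} (hs : 0 < s) (hst : s < t)
    (htT : t < T) : ‖g t - g s‖ ≤ (normDriver α T g).toReal * (t - s) ^ (1 - α) := by
  have h := le_self_add.trans (MemDriver.le_normDriver (α := α) (g := g) hs hst htT)
  rw [ENNReal.ofReal_le_iff_le_toReal hg.norm_lt_top.ne] at h
  rwa [div_le_iff₀ (Real.rpow_pos_of_pos (sub_pos.2 hst) _)] at h

/-- The driver norm only involves t < T; the endpoint is reached by monotone convergence along t ↑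
T. -/
theorem MemDriver.lintegral_le {s : ℝ} (hs : 0 < s) (hsT : s < T) :
    ∫⁻ y in Ioo s T, ENNReal.ofReal (‖g y - g s‖ / (y - s) ^ (2 - α)) ≤ normDriver α T g := by
  obtain ⟨u, hu, huT, hlim⟩ := exists_seq_strictMono_tendsto' hsT
  have hU : Ioo s T = ⋃ n, Ioo s (u n) := by
    ext y
    simp only [mem_Ioo, mem_iUnion]
    constructor
    · rintro ⟨h1, h2⟩
      obtain ⟨k, hk⟩ := (hlim.eventually (lt_mem_nhds h2)).exists
      exact ⟨k, h1, hk⟩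
    · rintro ⟨k, h1, h2⟩
      exact ⟨h1, h2.trans (huT k).2⟩
  rw [hU, setLIntegral_iUnion_of_directed]
  · exact iSup_le fun k => le_add_self.trans
      (MemDriver.le_normDriver hs (huT k).1 (huT k).2)
  · exact Monotone.directed_le fun i j hij => Ioo_subset_Ioo_right (hu.monotone hij)

theorem MemDriver.uniformContinuousOn (hα : α < 1) (hg : MemDriver α T g) :
    UniformContinuousOn g (Ioo 0 T) := by
  have hH : HolderOnWith (normDriver α T g).toNNReal (1 - α).toNNReal g (Ioo 0 T) := by
    have key : ∀ s ∈ Ioo 0 T, ∀ t ∈ Ioo 0 T, s < t → edist (g s) (g t) ≤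
        (normDriver α T g).toNNReal * edist s t ^ ((1 - α).toNNReal : ℝ) := by
      intro s hs t ht hst
      have h := hg.norm_sub_le hs.1 hst ht.2
      rw [edist_comm, edist_dist, dist_eq_norm, edist_comm s t, edist_dist, Real.dist_eq,
        abs_of_pos (sub_pos.2 hst), Real.coe_toNNReal _ (by linarith),
        ENNReal.ofReal_rpow_of_pos (sub_pos.2 hst), ENNReal.coe_toNNReal hg.norm_lt_top.ne]
      refine (ENNReal.ofReal_le_ofReal h).trans ?_
      rw [ENNReal.ofReal_mul ENNReal.toReal_nonneg, ENNReal.ofReal_toReal hg.norm_lt_top.ne]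
    intro s hs t ht
    rcases lt_trichotomy s t with h | rfl | h
    · exact key s hs t ht h
    · simp
    · rw [edist_comm, edist_comm s]
      exact key t ht s hs h
  exact hH.uniformContinuousOn (Real.toNNReal_pos.2 (by linarith))

/-- `Function.leftLim` falls back on the value g(T) when there is no limit. Here the limit exists,
because Hölder continuity on the open interval makes the left filter at T Cauchy. -/
theorem MemDriver.tendsto_leftLim (hα : α < 1) (hT : 0 < T) (hg : MemDriver α T g) :
    Tendsto g (𝓝[<] T) (𝓝 (Function.leftLim g T)) := by
  have hc : Cauchy (map g (𝓝[<] T)) := by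
    refine Metric.cauchy_iff.2 ⟨inferInstance, fun ε hε => ?_⟩
    obtain ⟨δ, hδ, h⟩ := Metric.uniformContinuousOn_iff.1 (hg.uniformContinuousOn hα) ε hε
    have hlt : max 0 (T - δ) < T := max_lt hT (by linarith)
    refine ⟨g '' Ioo (max 0 (T - δ)) T, image_mem_map (Ioo_mem_nhdsLT hlt), ?_⟩
    rintro _ ⟨a, ha, rfl⟩ _ ⟨b, hb, rfl⟩
    have h0 := le_max_left 0 (T - δ)
    have h1 := le_max_right 0 (T - δ)
    refine h a ⟨h0.trans_lt ha.1, ha.2⟩ b ⟨h0.trans_lt hb.1, hb.2⟩ ?_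
    rw [Real.dist_eq, abs_lt]
    constructor <;> linarith [ha.1, ha.2, hb.1, hb.2]
  obtain ⟨y, hy⟩ := cauchy_map_iff_exists_tendsto.1 hc
  rwa [leftLim_eq_of_tendsto hy]

/-- The constant g(t-) cancels in the differences. The cutoff matters only at y = t, a null set,
hence the passage to the open interval. -/
theorem weylRight_shiftLeft {F : Type*} [NormedAddCommGroup F] [NormedSpace ℝ F] (δ : ℝ)
    {g : ℝ → F} {s t : ℝ} (hs : 0 < s) (hst : s < t) :
    weylRight δ t (shiftLeft g t) s = (1 / Real.Gamma (1 - δ)) •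
      ((1 / (t - s) ^ δ) • (g s - Function.leftLim g t) +
        δ • ∫ y in s..t, (1 / (y - s) ^ (δ + 1)) • (g s - g y)) := by
  have hs' : shiftLeft g t s = g s - Function.leftLim g t := indicator_of_mem (show s ∈ Ioo 0 t from ⟨hs, hst⟩) _
  unfold weylRight
  rw [hs', intervalIntegral.integral_of_le hst.le, intervalIntegral.integral_of_le hst.le,
    integral_Ioc_eq_integral_Ioo, integral_Ioc_eq_integral_Ioo]
  congr 3
  refine setIntegral_congr_fun measurableSet_Ioo fun y hy => ?_
  have hy' : shiftLeft g t y = g y - Function.leftLim g t :=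
    indicator_of_mem (show y ∈ Ioo 0 t from ⟨hs.trans hy.1, hy.2⟩) _
  simp only [hy', sub_sub_sub_cancel_right]

theorem MemDriver.integrableOn (hg : MemDriver α T g) {s : ℝ} (hs : 0 < s) (hsT : s < T) :
    IntegrableOn (fun y => (1 / (y - s) ^ (1 - α + 1)) • (g s - g y)) (Ioo s T) := by
  have hm : AEStronglyMeasurable g (volume.restrict (Ioo s T)) := by
    have h := measurable_indicator_of_domRestrict hg.measurable
      ((Ioo_subset_Ioo_left hs.le).trans Ioo_subset_Icc_self) (measurableSet_Ioo (a := s) (b := T))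
    exact ((aemeasurable_indicator_iff measurableSet_Ioo).1 h.aemeasurable).aestronglyMeasurable
  refine ⟨?_, ?_⟩
  · have h1 : Measurable fun y : ℝ => 1 / (y - s) ^ (1 - α + 1) := by fun_prop
    exact h1.aestronglyMeasurable.smul (aestronglyMeasurable_const.sub hm)
  · refine lt_of_le_of_lt ?_ hg.norm_lt_top
    refine le_trans (le_of_eq ?_) (MemDriver.lintegral_le (α := α) (g := g) hs hsT)
    refine setLIntegral_congr_fun measurableSet_Ioo fun y hy => ?_
    have h0 : 0 < (y - s) ^ (1 - α + 1) := Real.rpow_pos_of_pos (sub_pos.2 hy.1) _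
    rw [← ofReal_norm, norm_smul, norm_sub_rev, Real.norm_of_nonneg (by positivity),
      show 2 - α = 1 - α + 1 by ring]
    congr 1
    ring

theorem Lam_nonneg (hα : α < 1) : 0 ≤ Lam α T g :=
  mul_nonneg (by have := Real.Gamma_pos_of_pos (sub_pos.2 hα); positivity) ENNReal.toReal_nonneg

/-- `Lam` takes `toReal` of a supremum, so it dominates its terms only once that supremum is known
to be finite. The driver norm G supplies this: both parts of the Weyl derivative are at most G, up
to the factor 1/Γ(α). -/
theorem MemDriver.norm_weylRight_le_of_lt (hα0 : 0 < α) (hα : α < 1) (hg : MemDriver α T g) {s t : ℝ}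
    (hs : 0 < s) (hst : s < t) (htT : t < T) :
    ‖weylRight (1 - α) t (shiftLeft g t) s‖ ≤ Real.Gamma (1 - α) * Lam α T g := by
  have hΓ := Real.Gamma_pos_of_pos (sub_pos.2 hα)
  have hΓ' := Real.Gamma_pos_of_pos hα0
  set G := (normDriver α T g).toReal with hG
  have hcont : ∀ t ∈ Ioo 0 T, Function.leftLim g t = g t := fun t ht =>
    leftLim_eq_of_tendsto ((((hg.uniformContinuousOn hα).continuousOn t ht).continuousAt
      (Ioo_mem_nhds ht.1 ht.2)).tendsto.mono_left nhdsWithin_le_nhds)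
  have hbound : ∀ s t, 0 < s ∧ s < t ∧ t < T →
      ‖weylRight (1 - α) t (shiftLeft g t) s‖ ≤ (1 / Real.Gamma α) * (G + G) := by
    rintro s t ⟨hs, hst, htT⟩
    rw [weylRight_shiftLeft _ hs hst, hcont t ⟨hs.trans hst, htT⟩, norm_smul, sub_sub_cancel,
      Real.norm_of_nonneg (by positivity)]
    have hp : 0 < (t - s) ^ (1 - α) := Real.rpow_pos_of_pos (sub_pos.2 hst) _
    refine mul_le_mul_of_nonneg_left ((norm_add_le _ _).trans (add_le_add ?_ ?_)) (by positivity)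
    · rw [norm_smul, Real.norm_of_nonneg (by positivity), norm_sub_rev, one_div_mul_eq_div,
        div_le_iff₀ hp]
      exact hg.norm_sub_le hs hst htT
    · rw [norm_smul, Real.norm_of_nonneg (by linarith)]
      have h1 : ‖∫ y in s..t, (1 / (y - s) ^ (1 - α + 1)) • (g s - g y)‖ ≤ G := by
        rw [intervalIntegral.integral_of_le hst.le, integral_Ioc_eq_integral_Ioo, hG,
          ← ENNReal.ofReal_le_iff_le_toReal hg.norm_lt_top.ne, ofReal_norm]
        refine (enorm_integral_le_lintegral_enorm _).trans ?_
        refine le_trans (le_of_eq ?_)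
          (le_add_self.trans (MemDriver.le_normDriver (α := α) (g := g) hs hst htT))
        refine setLIntegral_congr_fun measurableSet_Ioo fun y hy => ?_
        have h0 : 0 < (y - s) ^ (1 - α + 1) := Real.rpow_pos_of_pos (sub_pos.2 hy.1) _
        rw [← ofReal_norm, norm_smul, norm_sub_rev, Real.norm_of_nonneg (by positivity),
          show 2 - α = 1 - α + 1 by ring]
        congr 1
        ring
      have h2 : 0 ≤ G := ENNReal.toReal_nonneg
      nlinarith
  have hfin : (⨆ (s : ℝ) (t : ℝ) (_ : 0 < s ∧ s < t ∧ t < T),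
      ENNReal.ofReal ‖weylRight (1 - α) t (shiftLeft g t) s‖) ≠ ∞ :=
    ne_top_of_le_ne_top ENNReal.ofReal_ne_top
      (iSup_le fun s => iSup_le fun t => iSup_le fun h => ENNReal.ofReal_le_ofReal (hbound s t h))
  unfold Lam
  rw [← mul_assoc, mul_one_div_cancel hΓ.ne', one_mul, ← ENNReal.ofReal_le_iff_le_toReal hfin]
  exact le_iSup_of_le s (le_iSup_of_le t (le_iSup_of_le ⟨hs, hst, htT⟩ le_rfl))

/-- The Stieltjes integral uses the derivative at t = T, which the supremum in `Lam` omits. Letting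
t ↑ T transfers the bound: g(t-) = g(t) tends to g(T-), and the singular integral is continuous in
its upper limit. -/
theorem MemDriver.norm_weylRight_le (hα0 : 0 < α) (hα : α < 1) (hg : MemDriver α T g) {s : ℝ}
    (hs : 0 < s) (hsT : s < T) :
    ‖weylRight (1 - α) T (shiftLeft g T) s‖ ≤ Real.Gamma (1 - α) * Lam α T g := by
  have hcont : ∀ t ∈ Ioo 0 T, Function.leftLim g t = g t := fun t ht =>
    leftLim_eq_of_tendsto ((((hg.uniformContinuousOn hα).continuousOn t ht).continuousAt
      (Ioo_mem_nhds ht.1 ht.2)).tendsto.mono_left nhdsWithin_le_nhds)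
  have hint := ((intervalIntegral.continuousOn_primitive_interval (a := s) (b := T)
    (μ := volume) (f := fun y => (1 / (y - s) ^ (1 - α + 1)) • (g s - g y)) (by
      rw [uIcc_of_le hsT.le, integrableOn_Icc_iff_integrableOn_Ioo]
      exact hg.integrableOn hs hsT)) T right_mem_uIcc).tendsto
  rw [uIcc_of_le hsT.le] at hint
  have hint' := hint.mono_left (nhdsWithin_mono T (Ioo_subset_Icc_self (a := s)))
  rw [nhdsWithin_Ioo_eq_nhdsLT hsT] at hint'
  have hpow : Tendsto (fun t => 1 / (t - s) ^ (1 - α)) (𝓝[<] T) (𝓝 (1 / (T - s) ^ (1 - α))) := by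
    have h1 : ContinuousAt (fun t => 1 / (t - s) ^ (1 - α)) T := by
      refine ContinuousAt.div continuousAt_const ?_ (Real.rpow_pos_of_pos (sub_pos.2 hsT) _).ne'
      exact ContinuousAt.rpow_const (by fun_prop) (Or.inl (sub_pos.2 hsT).ne')
    exact h1.tendsto.mono_left nhdsWithin_le_nhds
  have hlim := (((hpow.smul ((hg.tendsto_leftLim hα (hs.trans hsT)).const_sub (g s))).add
    (hint'.const_smul (1 - α))).const_smul (1 / Real.Gamma (1 - (1 - α)))).norm
  rw [← weylRight_shiftLeft _ hs hsT] at hlim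
  refine le_of_tendsto hlim ?_
  filter_upwards [Ioo_mem_nhdsLT hsT] with t ht
  have := hg.norm_weylRight_le_of_lt hα0 hα hs ht.1 ht.2
  rwa [weylRight_shiftLeft _ hs ht.1, hcont t ⟨hs.trans ht.1, ht.2⟩] at this

theorem MemDriver.leftLim_apply (hα : α < 1) (hT : 0 < T) (hg : MemDriver α T g) (j : Fin n) :
    Function.leftLim (fun s => g s j) T = Function.leftLim g T j :=
  leftLim_eq_of_tendsto
    (((PiLp.continuous_apply 2 _ j).tendsto _).comp (hg.tendsto_leftLim hα hT))

theorem MemDriver.abs_weylRight_le (hα0 : 0 < α) (hα : α < 1) (hg : MemDriver α T g) {s : ℝ}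
    (hs : 0 < s) (hsT : s < T) (j : Fin n) :
    |weylRight (1 - α) T (shiftLeft (fun s => g s j) T) s| ≤ Real.Gamma (1 - α) * Lam α T g := by
  have hint : IntervalIntegrable (fun y => (1 / (y - s) ^ (1 - α + 1)) • (g s - g y)) volume s T :=
    (intervalIntegrable_iff_integrableOn_Ioo_of_le hsT.le).2 (hg.integrableOn hs hsT)
  have h := (EuclideanSpace.proj j : Eu n →L[ℝ] ℝ).intervalIntegral_comp_comm hint
  have heq : weylRight (1 - α) T (shiftLeft (fun s => g s j) T) s =
      weylRight (1 - α) T (shiftLeft g T) s j := by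
    rw [weylRight_shiftLeft _ hs hsT, weylRight_shiftLeft _ hs hsT,
      hg.leftLim_apply hα (hs.trans hsT)]
    simp only [PiLp.smul_apply, PiLp.add_apply, PiLp.sub_apply]
    congr 3
  rw [heq]
  exact (PiLp.norm_apply_le _ j).trans (hg.norm_weylRight_le hα0 hα hs hsT)

theorem measurable_weylRight {h : ℝ → ℝ} (hh : Measurable h) (δ b : ℝ) :
    Measurable (weylRight δ b h) := by
  have hk : Measurable (Function.uncurry fun s y : ℝ => (1 / (y - s) ^ (δ + 1)) • (h s - h y)) := by
    simp only [Function.uncurry_def]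
    fun_prop
  have h1 := measurable_intervalIntegral hk measurable_id (measurable_const (a := b))
  have h2 : Measurable fun s : ℝ => (1 / (b - s) ^ δ) • h s := by fun_prop
  exact (h2.add (h1.const_smul δ)).const_smul (1 / Real.Gamma (1 - δ))

theorem MemDriver.measurable_shiftLeft_apply (hg : MemDriver α T g) (j : Fin n) :
    Measurable (shiftLeft (fun s => g s j) T) := by
  refine measurable_indicator_of_domRestrict (s := Icc 0 T) ?_ Ioo_subset_Icc_self measurableSet_Ioo
  have h : Measurable fun s : Icc 0 T => g s j :=
    (PiLp.continuous_apply 2 _ j).measurable.comp hg.measurable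
  exact h.sub_const _

end Driver

/-! ### Increments of the generalized Stieltjes integral -/

section Stieltjes

variable {α T : ℝ} {f : ℝ → ℝ} {s t u P Q : ℝ}

/-- `f 1_{(0,t)} - f 1_{(0,s)}`. -/
noncomputable def slice (f : ℝ → ℝ) (s t : ℝ) (u : ℝ) : ℝ :=
  (Ioo 0 t).indicator f u - (Ioo 0 s).indicator f u

theorem slice_of_lt (hst : s ≤ t) (hus : u < s) : slice f s t u = 0 := by
  by_cases h0 : 0 < u
  · simp [slice, indicator, h0, hus, hus.trans_le hst]
  · simp [slice, indicator, h0]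

theorem slice_of_mem (h0 : 0 < u) (hsu : s ≤ u) (hut : u < t) : slice f s t u = f u := by
  simp [slice, indicator, h0, hut, not_lt.2 hsu]

theorem slice_of_ge (hst : s ≤ t) (htu : t ≤ u) : slice f s t u = 0 := by
  simp [slice, indicator, not_lt.2 htu, not_lt.2 (hst.trans htu)]

theorem slice_zero : slice f 0 t = (Ioo 0 t).indicator f := by
  ext u
  simp [slice]

/-- The modulus integral `∫_0^u |f(u) - f(v)| / (u - v)^{α+1} dv`. -/
noncomputable def fracInt (α : ℝ) (f : ℝ → ℝ) (u : ℝ) : ℝ≥0∞ :=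
  ∫⁻ v in Ioo 0 u, ENNReal.ofReal (|f u - f v| / (u - v) ^ (α + 1))

/-! ### Weyl derivatives of `f 1_{[s,t)}`. -/

theorem div_rpow_eq {a b : ℝ} (x : ℝ) (hab : a < b) :
    x / (b - a) ^ (α + 1) = x * (b - a) ^ (-α - 1) := by
  rw [div_eq_mul_inv, ← Real.rpow_neg (sub_pos.2 hab).le, neg_add, sub_eq_add_neg (-α)]

theorem lintegral_kernel (hα : 0 < α) (hP : 0 ≤ P) (hst : s ≤ t) (htu : t < u) :
    ∫⁻ v in Ioc s t, ENNReal.ofReal (P / (u - v) ^ (α + 1)) =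
      ENNReal.ofReal (P * ((u - t) ^ (-α) - (u - s) ^ (-α)) / α) := by
  have h1 : ∫⁻ v in Ioc s t, ENNReal.ofReal (P / (u - v) ^ (α + 1)) =
      ∫⁻ v in Ioc s t, ENNReal.ofReal P * ENNReal.ofReal ((u - v) ^ (-α - 1)) := by
    refine setLIntegral_congr_fun measurableSet_Ioc fun v hv => ?_
    rw [div_rpow_eq _ (hv.2.trans_lt htu), ENNReal.ofReal_mul hP]
  rw [h1, lintegral_const_mul' _ _ ENNReal.ofReal_ne_top,
    lintegral_Ioc_sub_rpow hst htu.le (Or.inr ⟨by linarith, htu⟩), ← ENNReal.ofReal_mul hP]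
  congr 1
  rw [sub_add_cancel]
  field_simp
  ring

/-- Points v < s see the jump from 0 to f(u), which costs P times a kernel integral; points v ≥ s
see increments of f itself, paid for by Q. -/
theorem fracInt_slice_of_mem (hα : 0 < α) (hP : 0 ≤ P) (hs : 0 ≤ s) (hsu : s < u) (hut : u < t)
    (hfP : |f u| ≤ P) (hfQ : fracInt α f u ≤ ENNReal.ofReal Q) :
    fracInt α (slice f s t) u ≤
      ENNReal.ofReal (P * ((u - s) ^ (-α) - u ^ (-α)) / α) + ENNReal.ofReal Q := by
  have hst : s ≤ t := (hsu.trans hut).le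
  have h0 : 0 < u := hs.trans_lt hsu
  have hsub : Ioo 0 u ⊆ Ioo 0 s ∪ (Ioo 0 u ∩ Ici s) := fun v hv => by
    rcases lt_or_ge v s with h | h
    · exact Or.inl ⟨hv.1, h⟩
    · exact Or.inr ⟨hv, h⟩
  have hu := slice_of_mem (f := f) h0 hsu.le hut
  unfold fracInt at hfQ ⊢
  refine (lintegral_mono_set hsub).trans ((lintegral_union_le _ _ _).trans (add_le_add ?_ ?_))
  · have h := lintegral_kernel hα hP hs hsu
    rw [sub_zero] at h
    rw [← h]
    refine le_trans (setLIntegral_mono' measurableSet_Ioo fun v hv => ?_)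
      (lintegral_mono_set Ioo_subset_Ioc_self)
    rw [hu, slice_of_lt hst hv.2, sub_zero]
    have : 0 ≤ u - v := by linarith [hv.2]
    exact ENNReal.ofReal_le_ofReal (by gcongr)
  · refine le_trans ?_ hfQ
    refine le_trans (setLIntegral_mono' (measurableSet_Ioo.inter measurableSet_Ici)
      fun v hv => ?_) (lintegral_mono_set inter_subset_left)
    rw [hu, slice_of_mem hv.1.1 hv.2 (hv.1.2.trans hut)]

/-- Beyond t the truncated function vanishes but its fractional derivative does not: the values of f
on [s, t) leave a tail. -/
theorem fracInt_slice_of_gt (hα : 0 < α) (hP : 0 ≤ P) (hst : s ≤ t) (htu : t < u)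
    (hfP : ∀ v ∈ Ioo 0 t, |f v| ≤ P) :
    fracInt α (slice f s t) u ≤
      ENNReal.ofReal (P * ((u - t) ^ (-α) - (u - s) ^ (-α)) / α) := by
  rw [← lintegral_kernel hα hP hst htu]
  have hsub : Ioo 0 u ⊆ (Ioo 0 u ∩ Ico s t) ∪ (Ioo 0 u \ Ico s t) := fun v hv => by
    by_cases h : v ∈ Ico s t
    · exact Or.inl ⟨hv, h⟩
    · exact Or.inr ⟨hv, h⟩
  have hu := slice_of_ge (f := f) hst htu.le
  refine (lintegral_mono_set hsub).trans ((lintegral_union_le _ _ _).trans ?_)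
  rw [← add_zero (∫⁻ v in Ioc s t, _)]
  refine add_le_add ?_ (le_of_eq ?_)
  · rw [← setLIntegral_congr Ico_ae_eq_Ioc]
    refine le_trans (setLIntegral_mono' (measurableSet_Ioo.inter measurableSet_Ico) fun v hv => ?_)
      (lintegral_mono_set inter_subset_right)
    rw [hu, slice_of_mem hv.1.1 hv.2.1 hv.2.2, zero_sub, abs_neg]
    have : 0 ≤ u - v := by linarith [hv.1.2]
    have := hfP v ⟨hv.1.1, hv.2.2⟩
    exact ENNReal.ofReal_le_ofReal (by gcongr)
  · refine (setLIntegral_congr_fun (g := 0) (measurableSet_Ioo.diff measurableSet_Ico)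
      fun v hv => ?_).trans (by simp)
    have hv0 : slice f s t v = 0 := by
      rcases lt_or_ge v s with h | h
      · exact slice_of_lt hst h
      · exact slice_of_ge hst (not_lt.1 fun h' => hv.2 ⟨h, h'⟩)
    simp [hu, hv0]

/-- The majorant of `Γ(1-α) |D^α_{0+} (f 1_{[s,t)})|`. -/
noncomputable def sliceMajorant (α s t P Q : ℝ) (u : ℝ) : ℝ :=
  if u ≤ s then 0 else if u ≤ t then P * (u - s) ^ (-α) + Q
    else P * ((u - t) ^ (-α) - (u - s) ^ (-α))

theorem abs_weylLeft_le {G : ℝ → ℝ} {A : ℝ} (hα0 : 0 < α) (hα : α < 1) (hu : 0 < u) (hA : 0 ≤ A)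
    (h : fracInt α G u ≤ ENNReal.ofReal A) :
    |weylLeft α 0 G u| ≤ (1 / Real.Gamma (1 - α)) * (|G u| * u ^ (-α) + α * A) := by
  have hΓ := Real.Gamma_pos_of_pos (sub_pos.2 hα)
  have hI : |∫ y in (0)..u, (G u - G y) / (u - y) ^ (α + 1)| ≤ A := by
    rw [intervalIntegral.integral_of_le hu.le, integral_Ioc_eq_integral_Ioo,
      ← ENNReal.ofReal_le_ofReal_iff hA, ← Real.norm_eq_abs, ofReal_norm]
    refine (enorm_integral_le_lintegral_enorm _).trans (le_trans (le_of_eq ?_) h)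
    refine setLIntegral_congr_fun measurableSet_Ioo fun v hv => ?_
    rw [← ofReal_norm, norm_div, Real.norm_eq_abs,
      Real.norm_of_nonneg (Real.rpow_nonneg (by linarith [hv.2]) _)]
  unfold weylLeft
  rw [abs_mul, abs_of_pos (by positivity : 0 < 1 / Real.Gamma (1 - α)), sub_zero]
  refine mul_le_mul_of_nonneg_left ((abs_add_le _ _).trans (add_le_add (le_of_eq ?_) ?_))
    (by positivity)
  · rw [abs_div, abs_of_nonneg (Real.rpow_nonneg hu.le α), Real.rpow_neg hu.le, div_eq_mul_inv]
  · rw [abs_mul, abs_of_pos hα0]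
    exact mul_le_mul_of_nonneg_left hI hα0.le

theorem rpow_neg_sub_nonneg {x y : ℝ} (hα : 0 ≤ α) (hx : 0 < x) (hxy : x ≤ y) :
    0 ≤ x ^ (-α) - y ^ (-α) :=
  sub_nonneg.2 (Real.rpow_le_rpow_of_nonpos hx hxy (by linarith))

theorem abs_weylLeft_slice_le (hα0 : 0 < α) (hα : α < 1) (hP : 0 ≤ P) (hQ : 0 ≤ Q) (hs : 0 ≤ s)
    (hst : s ≤ t) (hfP : ∀ v ∈ Ioo 0 t, |f v| ≤ P)
    (hfQ : ∀ v ∈ Ioo 0 t, fracInt α f v ≤ ENNReal.ofReal Q) (hu : 0 < u) (hus : u ≠ s)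
    (hut : u ≠ t) :
    |weylLeft α 0 (slice f s t) u| ≤ (1 / Real.Gamma (1 - α)) * sliceMajorant α s t P Q u := by
  have hΓ := Real.Gamma_pos_of_pos (sub_pos.2 hα)
  unfold sliceMajorant
  rcases lt_or_gt_of_ne hus with h1 | h1
  · rw [if_pos h1.le]
    refine (abs_weylLeft_le (A := 0) hα0 hα hu le_rfl (le_of_eq ?_)).trans_eq ?_
    · refine (setLIntegral_congr_fun (g := 0) measurableSet_Ioo fun v hv => ?_).trans (by simp)
      simp [slice_of_lt hst h1, slice_of_lt hst (hv.2.trans h1)]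
    · simp [slice_of_lt hst h1]
  rw [if_neg (not_le.2 h1)]
  rcases lt_or_gt_of_ne hut with h2 | h2
  · rw [if_pos h2.le]
    have hd := rpow_neg_sub_nonneg hα0.le (sub_pos.2 h1) (by linarith : u - s ≤ u)
    have hA : 0 ≤ P * ((u - s) ^ (-α) - u ^ (-α)) / α := by positivity
    refine (abs_weylLeft_le hα0 hα hu (add_nonneg hA hQ) ?_).trans
      (mul_le_mul_of_nonneg_left ?_ (by positivity))
    · rw [ENNReal.ofReal_add hA hQ]
      exact fracInt_slice_of_mem hα0 hP hs h1 h2 (hfP u ⟨hu, h2⟩) (hfQ u ⟨hu, h2⟩)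
    -- The boundary term f(u) u^{-α} is offset by the -P u^{-α} of the kernel integral, leaving P (u
    -- - s)^{-α}; then αQ ≤ Q.
    · rw [slice_of_mem hu h1.le h2, mul_add, mul_div_cancel₀ _ hα0.ne']
      have h3 := mul_le_mul_of_nonneg_right (hfP u ⟨hu, h2⟩) (Real.rpow_nonneg hu.le (-α))
      nlinarith
  · rw [if_neg (not_le.2 h2)]
    have hd := rpow_neg_sub_nonneg hα0.le (sub_pos.2 h2) (by linarith : u - t ≤ u - s)
    refine (abs_weylLeft_le hα0 hα hu (by positivity)
      (fracInt_slice_of_gt hα0 hP hst h2 hfP)).trans_eq ?_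
    rw [slice_of_ge hst h2.le, mul_div_cancel₀ _ hα0.ne']
    simp

theorem intervalIntegrable_sliceMajorant_and_integral_le (hα : α < 1) (hP : 0 ≤ P)
    (hs : 0 ≤ s) (hst : s ≤ t) (htT : t ≤ T) :
    IntervalIntegrable (sliceMajorant α s t P Q) volume 0 T ∧
      ∫ u in (0)..T, sliceMajorant α s t P Q u ≤
        2 * P / (1 - α) * (t - s) ^ (1 - α) + Q * (t - s) := by
  have hα1 : -1 < -α := by linarith
  have e1 : EqOn (fun _ => (0 : ℝ)) (sliceMajorant α s t P Q) (uIoc 0 s) := fun u hu => by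
    rw [uIoc_of_le hs] at hu
    simp [sliceMajorant, hu.2]
  have e2 : EqOn (fun u => P * (u - s) ^ (-α) + Q) (sliceMajorant α s t P Q) (uIoc s t) :=
    fun u hu => by
      rw [uIoc_of_le hst] at hu
      simp [sliceMajorant, hu.2, not_le.2 hu.1]
  have e3 : EqOn (fun u => P * ((u - t) ^ (-α) - (u - s) ^ (-α))) (sliceMajorant α s t P Q)
      (uIoc t T) := fun u hu => by
    rw [uIoc_of_le htT] at hu
    simp [sliceMajorant, not_le.2 hu.1, not_le.2 (hst.trans_lt hu.1)]
  have i1 : IntervalIntegrable (sliceMajorant α s t P Q) volume 0 s :=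
    intervalIntegrable_const.congr e1
  have j2 : IntervalIntegrable (fun u => P * (u - s) ^ (-α)) volume s t :=
    (intervalIntegrable_rpow_sub hα1).const_mul P
  have i2 : IntervalIntegrable (sliceMajorant α s t P Q) volume s t :=
    (j2.add intervalIntegrable_const).congr e2
  have i3 : IntervalIntegrable (sliceMajorant α s t P Q) volume t T :=
    (((intervalIntegrable_rpow_sub hα1).sub (intervalIntegrable_rpow_sub hα1)).const_mul P).congr e3
  refine ⟨(i1.trans i2).trans i3, ?_⟩
  rw [← intervalIntegral.integral_add_adjacent_intervals (i1.trans i2) i3,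
    ← intervalIntegral.integral_add_adjacent_intervals i1 i2,
    ← intervalIntegral.integral_congr_ae (Eventually.of_forall fun u hu => e1 hu),
    ← intervalIntegral.integral_congr_ae (Eventually.of_forall fun u hu => e2 hu),
    ← intervalIntegral.integral_congr_ae (Eventually.of_forall fun u hu => e3 hu),
    intervalIntegral.integral_add j2 intervalIntegrable_const,
    intervalIntegral.integral_const_mul, intervalIntegral.integral_const_mul,
    intervalIntegral.integral_sub (intervalIntegrable_rpow_sub hα1)
      (intervalIntegrable_rpow_sub hα1),
    integral_rpow_sub hα1, integral_rpow_sub hα1, integral_rpow_sub hα1]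
  have hne : -α + 1 ≠ 0 := by linarith
  simp only [intervalIntegral.integral_zero, intervalIntegral.integral_const, sub_self,
    Real.zero_rpow hne, smul_eq_mul]
  rw [show -α + 1 = 1 - α by ring]
  -- The tail beyond t telescopes to at most P (t - s)^{1-α} / (1-α), the same as the singular part
  -- on [s, t]; hence the factor 2.
  have hm : (T - t) ^ (1 - α) ≤ (T - s) ^ (1 - α) :=
    Real.rpow_le_rpow (by linarith) (by linarith) (by linarith)
  have hm' : P / (1 - α) * (T - t) ^ (1 - α) ≤ P / (1 - α) * (T - s) ^ (1 - α) :=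
    mul_le_mul_of_nonneg_left hm (div_nonneg hP (by linarith))
  have : 0 + (P * (((t - s) ^ (1 - α) - 0) / (1 - α)) + (t - s) * Q) +
      P * (((T - t) ^ (1 - α) - 0) / (1 - α) - ((T - s) ^ (1 - α) - (t - s) ^ (1 - α)) / (1 - α)) =
      2 * P / (1 - α) * (t - s) ^ (1 - α) + Q * (t - s) +
        (P / (1 - α) * (T - t) ^ (1 - α) - P / (1 - α) * (T - s) ^ (1 - α)) := by ring
  linarith

/-! ### Hölder bound for the integral as a function of its upper limit. -/

theorem intervalIntegrable_of_fracInt {G : ℝ → ℝ} (hG : Measurable G) (hu : 0 < u)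
    (h : fracInt α G u < ∞) :
    IntervalIntegrable (fun y => (G u - G y) / (u - y) ^ (α + 1)) volume 0 u := by
  rw [intervalIntegrable_iff_integrableOn_Ioo_of_le hu.le]
  refine ⟨Measurable.aestronglyMeasurable (by fun_prop), lt_of_le_of_lt (le_of_eq ?_) h⟩
  refine setLIntegral_congr_fun measurableSet_Ioo fun v hv => ?_
  rw [← ofReal_norm, norm_div, Real.norm_eq_abs,
    Real.norm_of_nonneg (Real.rpow_nonneg (by linarith [hv.2]) _)]

theorem fracInt_indicator_lt_top (hα : 0 < α) (hP : 0 ≤ P) (ht : 0 ≤ t)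
    (hfP : ∀ v ∈ Ioo 0 t, |f v| ≤ P)
    (hfQ : ∀ v ∈ Ioo 0 t, fracInt α f v ≤ ENNReal.ofReal Q) (hu : 0 < u) (hut : u ≠ t) :
    fracInt α ((Ioo 0 t).indicator f) u < ∞ := by
  rw [← slice_zero]
  rcases lt_or_gt_of_ne hut with h | h
  · exact (fracInt_slice_of_mem hα hP le_rfl hu h (hfP u ⟨hu, h⟩) (hfQ u ⟨hu, h⟩)).trans_lt
      (ENNReal.add_lt_top.2 ⟨ENNReal.ofReal_lt_top, ENNReal.ofReal_lt_top⟩)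
  · exact (fracInt_slice_of_gt hα hP ht h hfP).trans_lt ENNReal.ofReal_lt_top

/-- Both integrability assumptions are needed because a divergent Bochner integral is assigned the
value 0, which would break additivity; they come from finiteness of `fracInt` away from the cutoff
point. -/
theorem weylLeft_sub {F G : ℝ → ℝ}
    (hF : IntervalIntegrable (fun y => (F u - F y) / (u - y) ^ (α + 1)) volume 0 u)
    (hG : IntervalIntegrable (fun y => (G u - G y) / (u - y) ^ (α + 1)) volume 0 u) :
    weylLeft α 0 (fun v => F v - G v) u = weylLeft α 0 F u - weylLeft α 0 G u := by
  unfold weylLeft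
  rw [← mul_sub, sub_zero, add_sub_add_comm, ← sub_div, ← mul_sub,
    ← intervalIntegral.integral_sub hF hG]
  congr 4
  ext y
  ring

theorem measurable_weylLeft {F : ℝ → ℝ} (hF : Measurable F) : Measurable (weylLeft α 0 F) := by
  have hk : Measurable (Function.uncurry fun s y : ℝ => (F s - F y) / (s - y) ^ (α + 1)) := by
    simp only [Function.uncurry_def]
    fun_prop
  have h1 := measurable_intervalIntegral hk (measurable_const (a := (0 : ℝ))) measurable_id
  have h2 : Measurable fun s : ℝ => F s / (s - 0) ^ α := by fun_prop
  exact (h2.add (h1.const_mul α)).const_mul (1 / Real.Gamma (1 - α))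

theorem abs_integral_weylLeft_sub_le {w : ℝ → ℝ} {W : ℝ} (hα0 : 0 < α) (hα : α < 1) (hP : 0 ≤ P)
    (hQ : 0 ≤ Q) (hs : 0 ≤ s) (hst : s ≤ t) (htT : t ≤ T)
    (hfm : ∀ v ≤ t, Measurable ((Ioo 0 v).indicator f)) (hfP : ∀ v ∈ Ioo 0 t, |f v| ≤ P)
    (hfQ : ∀ v ∈ Ioo 0 t, fracInt α f v ≤ ENNReal.ofReal Q) (hw : Measurable w) (hW : 0 ≤ W)
    (hwW : ∀ v ∈ Ioo 0 T, |w v| ≤ W) :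
    |(∫ u in (0)..T, weylLeft α 0 ((Ioo 0 t).indicator f) u * w u) -
      ∫ u in (0)..T, weylLeft α 0 ((Ioo 0 s).indicator f) u * w u| ≤
      W / Real.Gamma (1 - α) * (2 * P / (1 - α) * (t - s) ^ (1 - α) + Q * (t - s)) := by
  have hΓ := Real.Gamma_pos_of_pos (sub_pos.2 hα)
  have hT : 0 ≤ T := (hs.trans hst).trans htT
  have hbound : ∀ {D : ℝ → ℝ} {a b : ℝ},
      (∀ u, 0 < u → u ≠ a → u ≠ b →
        |D u| ≤ (1 / Real.Gamma (1 - α)) * sliceMajorant α a b P Q u) →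
      ∀ᵐ u, u ∈ Ioc 0 T → ‖D u * w u‖ ≤
        W / Real.Gamma (1 - α) * sliceMajorant α a b P Q u := by
    intro D a b h
    have hne : ∀ c : ℝ, ∀ᵐ u : ℝ, u ≠ c := fun c => compl_mem_ae_iff.2 (measure_singleton c)
    filter_upwards [hne a, hne b, hne T] with u ha hb hT' hu
    rw [norm_mul]
    calc ‖D u‖ * ‖w u‖
        ≤ (1 / Real.Gamma (1 - α)) * sliceMajorant α a b P Q u * W :=
          mul_le_mul (h u hu.1 ha hb) (hwW u ⟨hu.1, lt_of_le_of_ne hu.2 hT'⟩) (norm_nonneg _)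
            ((abs_nonneg _).trans (h u hu.1 ha hb))
      _ = _ := by ring
  have hint : ∀ b, 0 ≤ b → b ≤ t →
      IntervalIntegrable (fun u => weylLeft α 0 ((Ioo 0 b).indicator f) u * w u) volume 0 T := by
    intro b hb hbt
    have hmaj := (intervalIntegrable_sliceMajorant_and_integral_le (Q := Q) hα hP le_rfl hb
      (hbt.trans htT)).1.const_mul (W / Real.Gamma (1 - α))
    refine hmaj.mono_fun' (((measurable_weylLeft (hfm b hbt)).mul hw).aestronglyMeasurable) ?_
    rw [uIoc_of_le hT]
    refine (ae_restrict_iff' measurableSet_Ioc).2 (hbound fun u hu h1 h2 => ?_)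
    rw [← slice_zero]
    exact abs_weylLeft_slice_le hα0 hα hP hQ le_rfl hb
      (fun v hv => hfP v ⟨hv.1, hv.2.trans_le hbt⟩) (fun v hv => hfQ v ⟨hv.1, hv.2.trans_le hbt⟩)
      hu h1 h2
  have hmaj := intervalIntegrable_sliceMajorant_and_integral_le (Q := Q) hα hP hs hst htT
  rw [← intervalIntegral.integral_sub (hint t (hs.trans hst) le_rfl) (hint s hs hst)]
  have hle := intervalIntegral.norm_integral_le_of_norm_le (μ := volume) hT
    (f := fun u => weylLeft α 0 ((Ioo 0 t).indicator f) u * w u -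
      weylLeft α 0 ((Ioo 0 s).indicator f) u * w u) (by
    simp only [← sub_mul]
    refine hbound (a := s) (b := t) fun u hu h1 h2 => ?_
    have hF : ∀ b, 0 ≤ b → b ≤ t → u ≠ b → IntervalIntegrable (fun y =>
        ((Ioo 0 b).indicator f u - (Ioo 0 b).indicator f y) / (u - y) ^ (α + 1)) volume 0 u :=
      fun b hb hbt hub => intervalIntegrable_of_fracInt (hfm b hbt) hu
        (fracInt_indicator_lt_top hα0 hP hb (fun v hv => hfP v ⟨hv.1, hv.2.trans_le hbt⟩)
          (fun v hv => hfQ v ⟨hv.1, hv.2.trans_le hbt⟩) hu hub)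
    rw [← weylLeft_sub (hF t (hs.trans hst) le_rfl h2) (hF s hs hst h1)]
    exact abs_weylLeft_slice_le hα0 hα hP hQ hs hst hfP hfQ hu h1 h2)
    (hmaj.1.const_mul (W / Real.Gamma (1 - α)))
  rw [intervalIntegral.integral_const_mul] at hle
  exact hle.trans (mul_le_mul_of_nonneg_left hmaj.2 (by positivity))

theorem abs_stieltjes_sub_le {n : ℕ} {g : ℝ → Eu n} (hα0 : 0 < α) (hα : α < 1)
    (hg : MemDriver α T g) (hP : 0 ≤ P) (hQ : 0 ≤ Q) (hs : 0 ≤ s) (hst : s ≤ t) (htT : t ≤ T)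
    (hfm : ∀ v ≤ t, Measurable ((Ioo 0 v).indicator f)) (hfP : ∀ v ∈ Ioo 0 t, |f v| ≤ P)
    (hfQ : ∀ v ∈ Ioo 0 t, fracInt α f v ≤ ENNReal.ofReal Q) (j : Fin n) :
    |stieltjes α T ((Ioo 0 t).indicator f) (fun v => g v j) -
      stieltjes α T ((Ioo 0 s).indicator f) (fun v => g v j)| ≤
      Lam α T g * (2 * P / (1 - α) * (t - s) ^ (1 - α) + Q * (t - s)) := by
  have hΓ := Real.Gamma_pos_of_pos (sub_pos.2 hα)
  have h := abs_integral_weylLeft_sub_le hα0 hα hP hQ hs hst htT hfm hfP hfQ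
    (measurable_weylRight (hg.measurable_shiftLeft_apply j) (1 - α) T)
    (mul_nonneg hΓ.le (Lam_nonneg (T := T) (g := g) hα))
    (fun v hv => hg.abs_weylRight_le hα0 hα hv.1 hv.2 j)
  rw [mul_div_cancel_left₀ _ hΓ.ne'] at h
  unfold stieltjes
  rwa [← neg_sub', abs_neg]

end Stieltjes

/-! ### Norms and the regulator -/

theorem norm_le_card_mul {d : ℕ} {v : Eu d} {c : ℝ} (hc : 0 ≤ c) (h : ∀ i, |v i| ≤ c) :
    ‖v‖ ≤ d * c := by
  rw [EuclideanSpace.norm_eq, Real.sqrt_le_left (by positivity)]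
  have h1 : ∑ i, ‖v i‖ ^ 2 ≤ ∑ _i : Fin d, c ^ 2 := Finset.sum_le_sum fun i _ => by
    have := h i
    rw [Real.norm_eq_abs]
    gcongr
  refine h1.trans ?_
  have h2 : (d : ℝ) ≤ (d : ℝ) ^ 2 := by exact_mod_cast Nat.le_self_pow two_ne_zero d
  simp only [Finset.sum_const, Finset.card_univ, Fintype.card_fin, nsmul_eq_mul]
  rw [mul_pow]
  gcongr

section Norm

variable {d : ℕ} {α s τ τ' : ℝ} {x : ℝ → Eu d}

theorem normAlphaInf_mono (h : τ ≤ τ') : normAlphaInf α s τ x ≤ normAlphaInf α s τ' x :=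
  biSup_mono fun _ hu => ⟨hu.1, hu.2.trans h⟩

theorem norm_le_normAlphaInf (hfin : normAlphaInf α s τ x < ∞) {u : ℝ} (hu : u ∈ Icc s τ) :
    ‖x u‖ ≤ (normAlphaInf α s τ x).toReal := by
  rw [← ENNReal.ofReal_le_iff_le_toReal hfin.ne]
  exact le_self_add.trans (le_iSup₂ (f := fun u (_ : u ∈ Icc s τ) => ENNReal.ofReal ‖x u‖ +
    ∫⁻ v in Ioo s u, ENNReal.ofReal (‖x u - x v‖ / (u - v) ^ (α + 1))) u hu)

theorem lintegral_le_normAlphaInf {u : ℝ} (hu : u ∈ Icc s τ) :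
    ∫⁻ v in Ioo s u, ENNReal.ofReal (‖x u - x v‖ / (u - v) ^ (α + 1)) ≤ normAlphaInf α s τ x :=
  le_add_self.trans (le_iSup₂ (f := fun u (_ : u ∈ Icc s τ) => ENNReal.ofReal ‖x u‖ +
    ∫⁻ v in Ioo s u, ENNReal.ofReal (‖x u - x v‖ / (u - v) ^ (α + 1))) u hu)

/-- A path of finite norm up to time `0` which is `(1-α)`-Hölder afterwards. -/
theorem normAlphaInf_le_of_holder {r X κ : ℝ} (hα0 : 0 < α) (hα : α < 1 / 2) (hr : 0 < r)
    (hX : 0 ≤ X) (hκ : 0 ≤ κ) (hτ : 0 ≤ τ) (hfin : normAlphaInf α (-r) 0 x < ∞)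
    (hb : ∀ u ∈ Icc 0 τ, ‖x u‖ ≤ X)
    (hh : ∀ s t, 0 ≤ s → s ≤ t → t ≤ τ → ‖x t - x s‖ ≤ κ * (t - s) ^ (1 - α)) :
    normAlphaInf α (-r) τ x ≤ ENNReal.ofReal ((normAlphaInf α (-r) 0 x).toReal + X +
      κ * τ ^ (1 - 2 * α) * (1 / (1 - 2 * α) + 1 / α)) := by
  set a := (normAlphaInf α (-r) 0 x).toReal with ha
  have ha0 : 0 ≤ a := ENNReal.toReal_nonneg
  have haN : normAlphaInf α (-r) 0 x = ENNReal.ofReal a := (ENNReal.ofReal_toReal hfin.ne).symm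
  have h12 : 0 < 1 - 2 * α := by linarith
  refine iSup₂_le fun u hu => ?_
  rcases le_or_gt u 0 with hu0 | hu0
  · refine (le_iSup₂ (f := fun u (_ : u ∈ Icc (-r) 0) => ENNReal.ofReal ‖x u‖ +
      ∫⁻ v in Ioo (-r) u, ENNReal.ofReal (‖x u - x v‖ / (u - v) ^ (α + 1))) u
      ⟨hu.1, hu0⟩).trans ?_
    have h1 : 0 ≤ κ * τ ^ (1 - 2 * α) * (1 / (1 - 2 * α) + 1 / α) := by positivity
    exact haN.le.trans (ENNReal.ofReal_le_ofReal (by linarith))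
  have hpow : u ^ (1 - 2 * α) ≤ τ ^ (1 - 2 * α) := Real.rpow_le_rpow hu0.le hu.2 h12.le
  -- Hölder exponent 1 - α against the kernel of order α + 1 leaves (u - v)^{-2α}, integrable
  -- because α < 1/2.
  have hI1 : ∫⁻ v in Ioo 0 u, ENNReal.ofReal (‖x u - x v‖ / (u - v) ^ (α + 1)) ≤
      ENNReal.ofReal (κ * τ ^ (1 - 2 * α) * (1 / (1 - 2 * α))) := by
    calc _ ≤ ∫⁻ v in Ioo 0 u, ENNReal.ofReal κ * ENNReal.ofReal ((u - v) ^ (-2 * α)) := by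
          refine setLIntegral_mono' measurableSet_Ioo fun v hv => ?_
          have huv : 0 < u - v := sub_pos.2 hv.2
          rw [← ENNReal.ofReal_mul hκ]
          refine ENNReal.ofReal_le_ofReal ?_
          rw [div_le_iff₀ (Real.rpow_pos_of_pos huv _), mul_assoc, ← Real.rpow_add huv]
          have := hh v u hv.1.le hv.2.le hu.2
          rwa [show -2 * α + (α + 1) = 1 - α by ring]
      _ = ENNReal.ofReal (κ * (u ^ (1 - 2 * α) / (1 - 2 * α))) := by
          rw [lintegral_const_mul' _ _ ENNReal.ofReal_ne_top,
            lintegral_Ioo_sub_rpow hu0.le (by linarith), ← ENNReal.ofReal_mul hκ, sub_zero,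
            show -2 * α + 1 = 1 - 2 * α by ring]
      _ ≤ _ := by
          refine ENNReal.ofReal_le_ofReal ?_
          rw [mul_assoc, mul_one_div]
          gcongr
  -- Increments across time 0 are split at x(0). The positive part κ u^{1-α} meets a kernel integral
  -- of at most u^{-α}/α; for the past part, replacing u - v by the smaller 0 - v gives the modulus
  -- integral of the initial path at 0.
  have hI2 : ∫⁻ v in Ioc (-r) 0, ENNReal.ofReal (‖x u - x v‖ / (u - v) ^ (α + 1)) ≤
      ENNReal.ofReal (κ * τ ^ (1 - 2 * α) * (1 / α)) + ENNReal.ofReal a := by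
    have hle := lintegral_le_normAlphaInf (α := α) (x := x) (s := -r) (τ := 0)
      (right_mem_Icc.2 (by linarith))
    rw [← setLIntegral_congr Ioo_ae_eq_Ioc]
    calc _ ≤ ∫⁻ v in Ioo (-r) 0, (ENNReal.ofReal (κ * u ^ (1 - α) / (u - v) ^ (α + 1)) +
            ENNReal.ofReal (‖x 0 - x v‖ / (0 - v) ^ (α + 1))) := by
          refine setLIntegral_mono' measurableSet_Ioo fun v hv => ?_
          have hv0 : 0 < 0 - v := by linarith [hv.2]
          have huv : 0 < u - v := by linarith
          have hx0 : ‖x u - x 0‖ ≤ κ * u ^ (1 - α) := by simpa using hh 0 u le_rfl hu0.le hu.2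
          have hx : ‖x u - x v‖ ≤ κ * u ^ (1 - α) + ‖x 0 - x v‖ :=
            (norm_sub_le_norm_sub_add_norm_sub _ (x 0) _).trans (by gcongr)
          rw [← ENNReal.ofReal_add (by positivity) (by positivity)]
          refine ENNReal.ofReal_le_ofReal ?_
          calc _ ≤ (κ * u ^ (1 - α) + ‖x 0 - x v‖) / (u - v) ^ (α + 1) := by gcongr
            _ = κ * u ^ (1 - α) / (u - v) ^ (α + 1) + ‖x 0 - x v‖ / (u - v) ^ (α + 1) :=
              add_div _ _ _
            _ ≤ _ := by gcongr
      _ = (∫⁻ v in Ioc (-r) 0, ENNReal.ofReal (κ * u ^ (1 - α) / (u - v) ^ (α + 1))) +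
            ∫⁻ v in Ioo (-r) 0, ENNReal.ofReal (‖x 0 - x v‖ / (0 - v) ^ (α + 1)) := by
          rw [lintegral_add_left (by fun_prop), setLIntegral_congr Ioo_ae_eq_Ioc]
      _ ≤ _ := by
          rw [lintegral_kernel hα0 (by positivity) (by linarith) hu0]
          refine add_le_add (ENNReal.ofReal_le_ofReal ?_) (hle.trans haN.le)
          rw [mul_one_div]
          have h1 : 0 ≤ (u - -r) ^ (-α) := Real.rpow_nonneg (by linarith) _
          have h2 : u ^ (1 - α) * ((u - 0) ^ (-α) - (u - -r) ^ (-α)) ≤ τ ^ (1 - 2 * α) := by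
            have h3 : u ^ (1 - α) * u ^ (-α) = u ^ (1 - 2 * α) := by
              rw [← Real.rpow_add hu0]
              ring_nf
            have h4 : 0 ≤ u ^ (1 - α) * (u - -r) ^ (-α) := by positivity
            rw [sub_zero, mul_sub]
            linarith
          rw [mul_assoc]
          gcongr
  have hsplit : Ioo (-r) u ⊆ Ioc (-r) 0 ∪ Ioo 0 u := fun v hv => by
    rcases le_or_gt v 0 with h | h
    · exact Or.inl ⟨hv.1, h⟩
    · exact Or.inr ⟨h, hv.2⟩
  calc _ ≤ ENNReal.ofReal X + ((ENNReal.ofReal (κ * τ ^ (1 - 2 * α) * (1 / α)) +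
        ENNReal.ofReal a) + ENNReal.ofReal (κ * τ ^ (1 - 2 * α) * (1 / (1 - 2 * α)))) :=
        add_le_add (ENNReal.ofReal_le_ofReal (hb u ⟨hu0.le, hu.2⟩))
          ((lintegral_mono_set hsplit).trans ((lintegral_union_le _ _ _).trans
            (add_le_add hI2 hI1)))
    _ = _ := by
        rw [← ENNReal.ofReal_add (by positivity) ha0, ← ENNReal.ofReal_add (by positivity)
          (by positivity), ← ENNReal.ofReal_add hX (by positivity)]
        congr 1
        ring

end Norm

/-! ### Size and increments of the reflection term. -/

section Regulator

variable {d : ℕ} {z : ℝ → Eu d} {s t Z ω : ℝ}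

theorem negPart_le_abs_self (a : ℝ) : a⁻ ≤ |a| := sup_le (neg_le_abs a) (abs_nonneg a)

theorem bddAbove_negPart (hZ : ∀ u ∈ Icc 0 t, ‖z u‖ ≤ Z) (i : Fin d) :
    BddAbove (range fun u : Icc (0 : ℝ) t => (z u i)⁻) := by
  refine ⟨Z, ?_⟩
  rintro _ ⟨u, rfl⟩
  exact (negPart_le_abs_self _).trans ((PiLp.norm_apply_le (z u) i).trans (hZ u u.2))

theorem regulator_apply (i : Fin d) : regulator z t i = ⨆ s : Icc (0 : ℝ) t, (z s i)⁻ := rfl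

theorem norm_regulator_le (ht : 0 ≤ t) (hZ : ∀ u ∈ Icc 0 t, ‖z u‖ ≤ Z) :
    ‖regulator z t‖ ≤ d * Z := by
  have h0 : (0 : ℝ) ∈ Icc 0 t := ⟨le_rfl, ht⟩
  have : Nonempty (Icc (0 : ℝ) t) := ⟨⟨0, h0⟩⟩
  refine norm_le_card_mul ((norm_nonneg _).trans (hZ 0 h0)) fun i => ?_
  rw [regulator_apply, abs_of_nonneg (Real.iSup_nonneg fun u => negPart_nonneg _)]
  exact ciSup_le fun u => (negPart_le_abs_self _).trans ((PiLp.norm_apply_le (z u) i).trans (hZ u u.2))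

/-- A running maximum grows only when exceeded by a value on [s, t], and the negative part is
1-Lipschitz. The bound Z serves only to make the real suprema genuine. -/
theorem norm_regulator_sub_le (hs : 0 ≤ s) (hst : s ≤ t) (hZ : ∀ u ∈ Icc 0 t, ‖z u‖ ≤ Z)
    (hω : ∀ u ∈ Icc s t, ‖z u - z s‖ ≤ ω) :
    ‖regulator z t - regulator z s‖ ≤ d * ω := by
  have hω0 : 0 ≤ ω := (norm_nonneg _).trans (hω s ⟨le_rfl, hst⟩)
  have : Nonempty (Icc (0 : ℝ) t) := ⟨⟨0, le_rfl, hs.trans hst⟩⟩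
  have : Nonempty (Icc (0 : ℝ) s) := ⟨⟨0, le_rfl, hs⟩⟩
  refine norm_le_card_mul hω0 fun i => ?_
  have hbt := bddAbove_negPart hZ i
  have hbs : BddAbove (range fun u : Icc (0 : ℝ) s => (z u i)⁻) :=
    bddAbove_negPart (fun u hu => hZ u ⟨hu.1, hu.2.trans hst⟩) i
  have h1 : regulator z s i ≤ regulator z t i :=
    ciSup_le fun u => le_ciSup hbt (⟨u, u.2.1, u.2.2.trans hst⟩ : Icc (0 : ℝ) t)
  have h2 : regulator z t i ≤ regulator z s i + ω := by
    refine ciSup_le fun u => ?_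
    rcases le_total (u : ℝ) s with hus | hsu
    · have := le_ciSup hbs ⟨u, u.2.1, hus⟩
      exact this.trans (le_add_of_nonneg_right hω0)
    · have h3 : (z s i)⁻ ≤ regulator z s i := le_ciSup hbs ⟨s, hs, le_rfl⟩
      have h4 : |z u i - z s i| ≤ ω := (PiLp.norm_apply_le (z u - z s) i).trans (hω u ⟨hsu, u.2.2⟩)
      have h5 : (z u i)⁻ ≤ (z s i)⁻ + ω := by
        rw [negPart_def]
        refine sup_le ?_ (add_nonneg (negPart_nonneg _) hω0)
        have := neg_le_negPart (z s i)
        linarith [(abs_le.1 h4).1]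
      linarith
  rw [PiLp.sub_apply, abs_of_nonneg (sub_nonneg.2 h1)]
  linarith

end Regulator

/-! ### The stochastic integral along a path -/

section Diffusion

variable {d m : ℕ} {α β γ r T M₀ K₀ τ τ' a : ℝ} {σ : ℝ → Eu d → Mat d m} {x : ℝ → Eu d}

theorem measurable_indicator_diffusion (hr : 0 < r) (hσ : H1 T β M₀ σ)
    (hx : ContinuousOn x (Icc (-r) T)) (i : Fin d) (j : Fin m) {v : ℝ} (hv : v ≤ T) :
    Measurable ((Ioo 0 v).indicator fun s => σ s (x (s - r)) (i, j)) := by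
  refine measurable_indicator_of_domRestrict (s := Icc 0 T) ?_
    (Ioo_subset_Icc_self.trans (Icc_subset_Icc_right hv)) measurableSet_Ioo
  have hc : Continuous fun s : Icc 0 T => x (s - r) :=
    hx.comp_continuous (by fun_prop) fun s => ⟨by linarith [s.2.1], by linarith [s.2.2]⟩
  have h := hσ.measurable.comp (measurable_id.prodMk hc.measurable)
  exact (PiLp.continuous_apply 2 _ (i, j)).measurable.comp h

/-- For v < τ' ≤ τ + r the delayed time v - r stays below τ, where the path is already controlled.
-/
theorem abs_diffusion_le (hK : 0 ≤ K₀) (hγ0 : 0 ≤ γ) (hγ : γ ≤ 1) (hσ : H3 T γ K₀ σ)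
    (hτ'T : τ' ≤ T) (hx : ∀ u ∈ Icc (-r) τ, ‖x u‖ ≤ a) (hττ' : τ' ≤ τ + r) (i : Fin d) (j : Fin m)
    {v : ℝ} (hv : v ∈ Ioo 0 τ') : |σ v (x (v - r)) (i, j)| ≤ 2 * K₀ * (1 + a) := by
  have hxa := hx (v - r) ⟨by linarith [hv.1], by linarith [hv.2]⟩
  have hpow : ‖x (v - r)‖ ^ γ ≤ 1 + ‖x (v - r)‖ := by
    rcases le_total ‖x (v - r)‖ 1 with h | h
    · exact (Real.rpow_le_one (norm_nonneg _) h hγ0).trans (by linarith [norm_nonneg (x (v - r))])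
    · calc _ ≤ ‖x (v - r)‖ ^ (1 : ℝ) := Real.rpow_le_rpow_of_exponent_le h hγ
        _ ≤ _ := by rw [Real.rpow_one]; linarith
  calc |σ v (x (v - r)) (i, j)| ≤ ‖σ v (x (v - r))‖ :=
        PiLp.norm_apply_le (σ v (x (v - r))) (i, j)
    _ ≤ K₀ * (1 + ‖x (v - r)‖ ^ γ) := hσ _ v ⟨hv.1.le, hv.2.le.trans hτ'T⟩
    _ ≤ K₀ * (2 * (1 + a)) := by
        refine mul_le_mul_of_nonneg_left ?_ hK
        linarith [norm_nonneg (x (v - r))]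
    _ = _ := by ring

/-- The time increment of σ leaves the kernel (u - v)^{β-α-1}, integrable since β > α; the space
increment leaves, after translation by r, the modulus integral of x at u - r over (-r, u - r). -/
theorem fracInt_diffusion_le (hβ : α < β) (hM : 0 ≤ M₀) (hσ : H1 T β M₀ σ)
    (hτ'T : τ' ≤ T) (ha : 0 ≤ a)
    (hx : ∀ u ∈ Icc (-r) τ, ∫⁻ v in Ioo (-r) u, ENNReal.ofReal (‖x u - x v‖ / (u - v) ^ (α + 1)) ≤
      ENNReal.ofReal a) (hττ' : τ' ≤ τ + r) (i : Fin d) (j : Fin m) {u : ℝ} (hu : u ∈ Ioo 0 τ') :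
    fracInt α (fun s => σ s (x (s - r)) (i, j)) u ≤
      ENNReal.ofReal (M₀ * (T ^ (β - α) / (β - α) + 1) * (1 + a)) := by
  have hβα : 0 < β - α := sub_pos.2 hβ
  have hT : 0 < T := hu.1.trans (hu.2.trans_le hτ'T)
  have huT : u ∈ Icc 0 T := ⟨hu.1.le, hu.2.le.trans hτ'T⟩
  have hpre : ∫⁻ v in Ioo 0 u, ENNReal.ofReal (‖x (u - r) - x (v - r)‖ / (u - v) ^ (α + 1)) ≤
      ENNReal.ofReal a := by
    have hmp := measurePreserving_sub_right (volume : Measure ℝ) r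
    have h := hmp.setLIntegral_comp_preimage_emb (measurableEmbedding_subRight r)
      (fun v => ENNReal.ofReal (‖x (u - r) - x v‖ / (u - r - v) ^ (α + 1))) (Ioo (-r) (u - r))
    have hset : (fun v => v - r) ⁻¹' Ioo (-r) (u - r) = Ioo 0 u := by
      ext v
      simp only [mem_preimage, mem_Ioo]
      constructor <;> rintro ⟨h1, h2⟩ <;> constructor <;> linarith
    rw [hset] at h
    simp only [sub_sub_sub_cancel_right] at h
    rw [h]
    exact hx (u - r) ⟨by linarith [hu.1], by linarith [hu.2]⟩
  calc _ ≤ ∫⁻ v in Ioo 0 u, (ENNReal.ofReal M₀ * ENNReal.ofReal ((u - v) ^ (β - α - 1)) +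
          ENNReal.ofReal M₀ *
            ENNReal.ofReal (‖x (u - r) - x (v - r)‖ / (u - v) ^ (α + 1))) := by
        refine setLIntegral_mono' measurableSet_Ioo fun v hv => ?_
        have huv : 0 < u - v := sub_pos.2 hv.2
        have hvT : v ∈ Icc 0 T := ⟨hv.1.le, hv.2.le.trans huT.2⟩
        have hp : 0 < (u - v) ^ (α + 1) := Real.rpow_pos_of_pos huv _
        rw [← ENNReal.ofReal_mul hM, ← ENNReal.ofReal_mul hM,
          ← ENNReal.ofReal_add (by positivity) (by positivity)]
        refine ENNReal.ofReal_le_ofReal ?_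
        have h1 : |σ u (x (u - r)) (i, j) - σ v (x (v - r)) (i, j)| ≤
            M₀ * (u - v) ^ β + M₀ * ‖x (u - r) - x (v - r)‖ := by
          refine (PiLp.norm_apply_le (σ u (x (u - r)) - σ v (x (v - r))) (i, j)).trans ?_
          refine (norm_sub_le_norm_sub_add_norm_sub _ (σ v (x (u - r))) _).trans (add_le_add ?_ ?_)
          · have := hσ.holder (x (u - r)) u huT v hvT
            rwa [abs_of_pos huv] at this
          · exact hσ.lipschitz v hvT _ _
        rw [div_le_iff₀ hp, add_mul, mul_assoc M₀, mul_assoc M₀, div_mul_cancel₀ _ hp.ne',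
          ← Real.rpow_add huv, show β - α - 1 + (α + 1) = β by ring]
        exact h1
    _ = ENNReal.ofReal M₀ * ENNReal.ofReal (u ^ (β - α) / (β - α)) + ENNReal.ofReal M₀ *
          ∫⁻ v in Ioo 0 u, ENNReal.ofReal (‖x (u - r) - x (v - r)‖ / (u - v) ^ (α + 1)) := by
        rw [lintegral_add_left (by fun_prop), lintegral_const_mul' _ _ ENNReal.ofReal_ne_top,
          lintegral_const_mul' _ _ ENNReal.ofReal_ne_top,
          lintegral_Ioo_sub_rpow hu.1.le (by linarith), sub_zero, sub_add_cancel]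
    _ ≤ ENNReal.ofReal M₀ * ENNReal.ofReal (T ^ (β - α) / (β - α)) +
          ENNReal.ofReal M₀ * ENNReal.ofReal a := by
        have := huT.2
        have := hu.1.le
        gcongr
    _ ≤ _ := by
        rw [← ENNReal.ofReal_mul hM, ← ENNReal.ofReal_mul hM,
          ← ENNReal.ofReal_add (by positivity) (by positivity)]
        refine ENNReal.ofReal_le_ofReal ?_
        have h0 : 0 ≤ T ^ (β - α) / (β - α) := by positivity
        have : 0 ≤ M₀ * (1 + T ^ (β - α) / (β - α) * a) := by positivity
        linarith

theorem norm_stieltjesVec_sub_le {g : ℝ → Eu m} (hr : 0 < r) (hα0 : 0 < α) (hα : α < 1)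
    (hβ : α < β) (hM : 0 ≤ M₀) (hK : 0 ≤ K₀) (hγ0 : 0 ≤ γ) (hγ : γ ≤ 1) (h1 : H1 T β M₀ σ)
    (h3 : H3 T γ K₀ σ) (hg : MemDriver α T g) (hxc : ContinuousOn x (Icc (-r) T)) (hτ'T : τ' ≤ T)
    (hττ' : τ' ≤ τ + r) (hfin : normAlphaInf α (-r) τ x < ∞) {s t : ℝ} (hs : 0 ≤ s) (hst : s ≤ t)
    (ht : t ≤ τ') :
    ‖stieltjesVec α T (fun s => σ s (x (s - r))) g t -
      stieltjesVec α T (fun s => σ s (x (s - r))) g s‖ ≤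
    d * m * (4 * K₀ / (1 - α) + M₀ * (T ^ (β - α) / (β - α) + 1) * T ^ α) *
      (Lam α T g * (1 + (normAlphaInf α (-r) τ x).toReal)) * (t - s) ^ (1 - α) := by
  set a := (normAlphaInf α (-r) τ x).toReal with ha_def
  have ha : 0 ≤ a := ENNReal.toReal_nonneg
  have hT : 0 ≤ T := (hs.trans hst).trans (ht.trans hτ'T)
  have hβα : 0 < β - α := sub_pos.2 hβ
  have h1α : 0 < 1 - α := sub_pos.2 hα
  have hΛ := Lam_nonneg (T := T) (g := g) hα
  have hts : 0 ≤ t - s := sub_nonneg.2 hst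
  have hxa : ∀ u ∈ Icc (-r) τ, ‖x u‖ ≤ a := fun u hu => norm_le_normAlphaInf hfin hu
  have hxi : ∀ u ∈ Icc (-r) τ, ∫⁻ v in Ioo (-r) u,
      ENNReal.ofReal (‖x u - x v‖ / (u - v) ^ (α + 1)) ≤ ENNReal.ofReal a := fun u hu =>
    (lintegral_le_normAlphaInf hu).trans_eq (ENNReal.ofReal_toReal hfin.ne).symm
  set q := M₀ * (T ^ (β - α) / (β - α) + 1) with hq_def
  have hq : 0 ≤ q := by positivity
  -- Puts the Lipschitz contribution of the modulus Q on the same (1-α)-Hölder scale as that of P.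
  have hts' : t - s ≤ T ^ α * (t - s) ^ (1 - α) := by
    rcases hts.eq_or_lt with h0 | h0
    · rw [← h0, Real.zero_rpow h1α.ne', mul_zero]
    · calc t - s = (t - s) ^ α * (t - s) ^ (1 - α) := by
            rw [← Real.rpow_add h0, add_sub_cancel, Real.rpow_one]
        _ ≤ _ := by
            gcongr
            linarith
  have hcoord : ∀ i j, |stieltjes α T ((Ioo 0 t).indicator fun s => σ s (x (s - r)) (i, j))
      (fun v => g v j) - stieltjes α T ((Ioo 0 s).indicator fun s => σ s (x (s - r)) (i, j))
      (fun v => g v j)| ≤ (4 * K₀ / (1 - α) + q * T ^ α) * (Lam α T g * (1 + a)) *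
        (t - s) ^ (1 - α) := by
    intro i j
    refine (abs_stieltjes_sub_le (P := 2 * K₀ * (1 + a)) (Q := q * (1 + a)) hα0 hα hg
      (by positivity) (by positivity) hs hst (ht.trans hτ'T)
      (fun v hv => measurable_indicator_diffusion hr h1 hxc i j (hv.trans (ht.trans hτ'T)))
      (fun v hv => abs_diffusion_le hK hγ0 hγ h3 hτ'T hxa hττ' i j ⟨hv.1, hv.2.trans_le ht⟩)
      (fun v hv => fracInt_diffusion_le hβ hM h1 hτ'T ha hxi hττ' i j ⟨hv.1, hv.2.trans_le ht⟩)
      j).trans ?_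
    have h := mul_le_mul_of_nonneg_left hts' (by positivity : 0 ≤ q * (1 + a))
    calc _ ≤ Lam α T g * (2 * (2 * K₀ * (1 + a)) / (1 - α) * (t - s) ^ (1 - α) +
          q * (1 + a) * (T ^ α * (t - s) ^ (1 - α))) :=
          mul_le_mul_of_nonneg_left (by linarith) hΛ
      _ = _ := by ring
  have hc0 : 0 ≤ (4 * K₀ / (1 - α) + q * T ^ α) * (Lam α T g * (1 + a)) * (t - s) ^ (1 - α) := by
    positivity
  refine (norm_le_card_mul (mul_nonneg m.cast_nonneg hc0) fun i => ?_).trans_eq (by ring)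
  have : (stieltjesVec α T (fun s => σ s (x (s - r))) g t -
      stieltjesVec α T (fun s => σ s (x (s - r))) g s) i = ∑ j : Fin m,
      (stieltjes α T ((Ioo 0 t).indicator fun s => σ s (x (s - r)) (i, j)) (fun v => g v j) -
        stieltjes α T ((Ioo 0 s).indicator fun s => σ s (x (s - r)) (i, j)) (fun v => g v j)) := by
    rw [Finset.sum_sub_distrib]
    rfl
  rw [this]
  refine (Finset.abs_sum_le_sum_abs _ _).trans ((Finset.sum_le_sum fun j _ => hcoord i j).trans_eq ?_)
  simp

theorem stieltjesVec_zero {g : ℝ → Eu m} (f : ℝ → Mat d m) : stieltjesVec α T f g 0 = 0 := by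
  ext i
  simp [stieltjesVec, stieltjes, weylLeft]

end Diffusion

/-! ### The drift along a path -/

section Drift

variable {d : ℕ} {r T ρ α L₀ B₀ : ℝ} {b : ℝ → CPath d r T → Eu d} {L b₀ : ℝ → ℝ}
  {p : CPath d r T}

theorem bddAbove_supUpTo (p : CPath d r T) (t : ℝ) :
    BddAbove (range fun s : {s : Icc (-r) T // (s : ℝ) ≤ t} => ‖p s.1‖) :=
  ⟨‖p‖, by rintro _ ⟨s, rfl⟩; exact p.norm_coe_le_norm _⟩

theorem norm_le_supUpTo {s t : ℝ} (hs : s ∈ Icc (-r) T) (hst : s ≤ t) : ‖p ⟨s, hs⟩‖ ≤ supUpTo p t :=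
  le_ciSup (bddAbove_supUpTo p t) (⟨⟨s, hs⟩, hst⟩ : {s : Icc (-r) T // (s : ℝ) ≤ t})

theorem supUpTo_le {t B : ℝ} (hB : 0 ≤ B)
    (h : ∀ s (hs : s ∈ Icc (-r) T), s ≤ t → ‖p ⟨s, hs⟩‖ ≤ B) : supUpTo p t ≤ B :=
  Real.iSup_le (fun s => h s.1 s.1.2 s.2) hB

theorem supUpTo_nonneg (p : CPath d r T) (t : ℝ) : 0 ≤ supUpTo p t :=
  Real.iSup_nonneg fun _ => norm_nonneg _

theorem monotone_supUpTo (p : CPath d r T) : Monotone (supUpTo p) := fun _ t hst =>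
  supUpTo_le (supUpTo_nonneg p t) fun _ hu hus => norm_le_supUpTo hu (hus.trans hst)

/-- Hölder's inequality with exponent 1/α: the drift remainder then has the same regularity 1 - α as
the Stieltjes integral. -/
theorem integral_le_of_eLpNorm_le (hα0 : 0 < α) (hα : α < 1)
    (hb₀ : MemLp b₀ (ENNReal.ofReal (1 / α)) (volume.restrict (Ioc 0 T)))
    (hB₀ : 0 ≤ B₀)
    (hle : eLpNorm b₀ (ENNReal.ofReal (1 / α)) (volume.restrict (Ioc 0 T)) ≤ ENNReal.ofReal B₀)
    {s t : ℝ} (hs : 0 ≤ s) (hst : s ≤ t) (htT : t ≤ T) :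
    ∫ u in s..t, b₀ u ≤ B₀ * (t - s) ^ (1 - α) := by
  have hsub : Ioc s t ⊆ Ioc 0 T := Ioc_subset_Ioc hs htT
  have hmem := hb₀.mono_measure (Measure.restrict_mono hsub le_rfl)
  have h1 : (1 : ℝ≥0∞) ≤ ENNReal.ofReal (1 / α) := by
    rw [ENNReal.one_le_ofReal, le_div_iff₀ hα0]
    linarith
  have h := eLpNorm_le_eLpNorm_mul_rpow_measure_univ h1 hmem.1
  rw [ENNReal.toReal_one, ENNReal.toReal_ofReal (by positivity), Measure.restrict_apply_univ,
    Real.volume_Ioc, one_div_one_div, div_one, eLpNorm_one_eq_lintegral_enorm,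
    ENNReal.ofReal_rpow_of_nonneg (sub_nonneg.2 hst) (by linarith)] at h
  have h2 := h.trans (mul_le_mul_left ((eLpNorm_mono_measure _
    (Measure.restrict_mono hsub le_rfl)).trans hle) _)
  rw [← ENNReal.ofReal_mul hB₀] at h2
  refine (le_abs_self _).trans ?_
  rw [← Real.norm_eq_abs, ← ENNReal.ofReal_le_ofReal_iff
    (mul_nonneg hB₀ (Real.rpow_nonneg (sub_nonneg.2 hst) _)), ofReal_norm,
    intervalIntegral.integral_of_le hst]
  exact (enorm_integral_le_lintegral_enorm _).trans h2

theorem intervalIntegrable_growth (hα0 : 0 < α) (hα : α < 1) (hT : 0 ≤ T)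
    (hb₀ : MemLp b₀ (ENNReal.ofReal (1 / α)) (volume.restrict (Ioc 0 T))) :
    IntervalIntegrable b₀ volume 0 T := by
  rw [intervalIntegrable_iff_integrableOn_Ioc_of_le hT]
  refine hb₀.integrable ?_
  rw [ENNReal.one_le_ofReal, le_div_iff₀ hα0]
  linarith

theorem intervalIntegrable_drift (hα0 : 0 < α) (hα : α < 1) (hT : 0 ≤ T)
    (hb : H2 r T (1 / α) b L b₀) (p : CPath d r T) :
    IntervalIntegrable (fun u => b u p) volume 0 T := by
  have hmaj : IntervalIntegrable (fun u => L 0 * supUpTo p u + b₀ u) volume 0 T :=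
    ((monotone_supUpTo p).intervalIntegrable.const_mul _).add
      (intervalIntegrable_growth hα0 hα hT hb.memLp)
  refine hmaj.mono_fun' ?_ ?_
  · rw [uIoc_of_le hT]
    have h : Measurable ((Icc 0 T).domRestrict fun u => b u p) := by
      let _ : MeasurableSpace (CPath d r T) := borel _
      exact hb.measurable.comp (measurable_id.prodMk measurable_const)
    have h' := measurable_indicator_of_domRestrict h Ioc_subset_Icc_self
      (measurableSet_Ioc (a := 0) (b := T))
    exact ((aemeasurable_indicator_iff measurableSet_Ioc).1 h'.aemeasurable).aestronglyMeasurable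
  · rw [uIoc_of_le hT]
    exact (ae_restrict_mem measurableSet_Ioc).mono fun u hu =>
      hb.growth p u (Ioc_subset_Icc_self hu)

theorem norm_integral_drift_sub_le (hα0 : 0 < α) (hα : α < 1) (hb : H2 r T (1 / α) b L b₀)
    (hB₀ : 0 ≤ B₀)
    (hle : eLpNorm b₀ (ENNReal.ofReal (1 / α)) (volume.restrict (Ioc 0 T)) ≤ ENNReal.ofReal B₀)
    {s t : ℝ} (hs : 0 ≤ s) (hst : s ≤ t) (htT : t ≤ T) :
    ‖(∫ u in (0)..t, b u p) - ∫ u in (0)..s, b u p‖ ≤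
      L 0 * (∫ u in s..t, supUpTo p u) + B₀ * (t - s) ^ (1 - α) := by
  have hT : 0 ≤ T := (hs.trans hst).trans htT
  have hbi := intervalIntegrable_drift hα0 hα hT hb p
  have hsub : ∀ {u v}, 0 ≤ u → u ≤ v → v ≤ T → uIcc u v ⊆ uIcc 0 T := fun hu huv hv => by
    rw [uIcc_of_le huv, uIcc_of_le hT]
    exact Icc_subset_Icc hu hv
  rw [intervalIntegral.integral_interval_sub_left
    (hbi.mono_set (hsub le_rfl (hs.trans hst) htT)) (hbi.mono_set (hsub le_rfl hs (hst.trans htT)))]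
  have hb₀ := (intervalIntegrable_growth hα0 hα hT hb.memLp).mono_set (hsub hs hst htT)
  have hS : IntervalIntegrable (fun u => L 0 * supUpTo p u) volume s t :=
    (monotone_supUpTo p).intervalIntegrable.const_mul _
  refine (intervalIntegral.norm_integral_le_of_norm_le hst (Eventually.of_forall fun u hu =>
    hb.growth p u ⟨hs.trans hu.1.le, hu.2.trans htT⟩) (hS.add hb₀)).trans ?_
  rw [intervalIntegral.integral_add hS hb₀, intervalIntegral.integral_const_mul]
  exact add_le_add_right (integral_le_of_eLpNorm_le hα0 hα hb.memLp hB₀ hle hs hst htT) _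

end Drift

/-! ### A priori bounds -/

section Solution

variable {d m : ℕ} {α β γ r T M₀ K₀ B₀ τ θ : ℝ} {b : ℝ → CPath d r T → Eu d}
  {σ : ℝ → Eu d → Mat d m} {g : ℝ → Eu m} {η x : ℝ → Eu d} {L b₀ : ℝ → ℝ}

theorem reflector_zero (hx : ContinuousOn x (Icc (-r) T)) :
    reflector α b σ g η x hx 0 = η 0 := by
  simp [reflector, stieltjesVec_zero]

/-- The equation is imposed for t > 0 only; at t = 0 it holds because η(0) is in the orthant, so
there is nothing to reflect. -/
theorem IsSolution.eq_add (h : IsSolution α r T b σ g η x) (hη : MemWPos α (-r) 0 η) (hr : 0 < r)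
    {t : ℝ} (ht : t ∈ Icc 0 T) :
    x t = reflector α b σ g η x h.continuousOn t +
      regulator (reflector α b σ g η x h.continuousOn) t := by
  rcases ht.1.eq_or_lt with rfl | h0
  · rw [reflector_zero, h.initial 0 ⟨by linarith, le_rfl⟩]
    have hreg : regulator (reflector α b σ g η x h.continuousOn) 0 = 0 := by
      ext i
      have h1 : ∀ s : Icc (0 : ℝ) 0, (reflector α b σ g η x h.continuousOn s i)⁻ = 0 := by
        intro s
        rw [show (s : ℝ) = 0 from le_antisymm s.2.2 s.2.1, reflector_zero, negPart_eq_zero]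
        exact hη.nonneg 0 ⟨by linarith, le_rfl⟩ i
      rw [regulator_apply]
      simp [h1]
    rw [hreg, add_zero]
  · exact h.equation t ⟨h0, ht.2⟩

theorem supUpTo_pathOf_le (hx : ContinuousOn x (Icc (-r) T)) {t B : ℝ} (hB : 0 ≤ B)
    (h : ∀ s ∈ Icc (-r) T, s ≤ t → ‖x s‖ ≤ B) : supUpTo (pathOf x hx) t ≤ B :=
  supUpTo_le hB fun s hs hst => h s hs hst

theorem norm_le_supUpTo_pathOf (hx : ContinuousOn x (Icc (-r) T)) {s t : ℝ} (hs : s ∈ Icc (-r) T)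
    (hst : s ≤ t) : ‖x s‖ ≤ supUpTo (pathOf x hx) t :=
  norm_le_supUpTo (p := pathOf x hx) hs hst

/-- The growth constant for the supremum of a solution. -/
noncomputable def supConst (d : ℕ) (α L₀ T : ℝ) : ℝ :=
  2 * (1 + d) * (1 + T ^ (1 - α)) * Real.exp (2 * ((1 + d) * L₀) * T)

/-- With the rough part frozen into θ, only the drift feeds back. Since |x| ≤ |z| + |y| costs a
factor `1 + d`, the running supremum S satisfies a linear integral inequality, and Gronwall closes
it. -/
theorem IsSolution.norm_le (hα : α < 1) (h : IsSolution α r T b σ g η x)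
    (hη : MemWPos α (-r) 0 η) (hr : 0 < r) {L₀ : ℝ} (hL₀ : 0 < L₀) (hτ0 : 0 ≤ τ) (hτT : τ ≤ T)
    (hθ : 0 ≤ θ)
    (hz : ∀ s t, 0 ≤ s → s ≤ t → t ≤ τ → ‖reflector α b σ g η x h.continuousOn t -
      reflector α b σ g η x h.continuousOn s‖ ≤
      L₀ * (∫ u in s..t, supUpTo (pathOf x h.continuousOn) u) + θ * (t - s) ^ (1 - α)) :
    ∀ t ∈ Icc 0 τ, supUpTo (pathOf x h.continuousOn) t ≤
      supConst d α L₀ T * ((normAlphaInf α (-r) 0 x).toReal + θ) := by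
  set z := reflector α b σ g η x h.continuousOn with hz_def
  set S := supUpTo (pathOf x h.continuousOn) with hS_def
  set a := (normAlphaInf α (-r) 0 x).toReal with ha_def
  have ha : 0 ≤ a := ENNReal.toReal_nonneg
  have hT : 0 ≤ T := hτ0.trans hτT
  have h1α : 0 < 1 - α := sub_pos.2 hα
  have hfin : normAlphaInf α (-r) 0 x < ∞ := (normAlphaInf_mono hT).trans_lt h.memW.norm_lt_top
  have hS0 : ∀ u, 0 ≤ S u := supUpTo_nonneg _
  have hmono : Monotone S := monotone_supUpTo _
  have hxa : ∀ u ∈ Icc (-r) 0, ‖x u‖ ≤ a := fun u hu => norm_le_normAlphaInf hfin hu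
  have hz0 : z 0 = x 0 := by rw [hz_def, reflector_zero, h.initial 0 ⟨by linarith, le_rfl⟩]
  have hz0' : ‖z 0‖ ≤ a := by rw [hz0]; exact hxa 0 ⟨by linarith, le_rfl⟩
  have hbound : ∀ t ∈ Icc 0 τ, S t ≤ (1 + d) * (a + θ * T ^ (1 - α)) +
      (1 + d) * L₀ * ∫ u in (0)..t, S u := by
    intro t ht
    have hI0 : ∀ u, 0 ≤ u → 0 ≤ ∫ v in (0)..u, S v := fun u hu =>
      intervalIntegral.integral_nonneg hu fun v _ => hS0 v
    set Z := a + (L₀ * (∫ u in (0)..t, S u) + θ * T ^ (1 - α)) with hZ_def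
    have hZa : a ≤ Z := by
      have := mul_nonneg hL₀.le (hI0 t ht.1)
      have : 0 ≤ θ * T ^ (1 - α) := by positivity
      linarith
    have hzZ : ∀ u ∈ Icc 0 t, ‖z u‖ ≤ Z := by
      intro u hu
      have h1 := hz 0 u le_rfl hu.1 (hu.2.trans ht.2)
      have h2 : ∫ v in (0)..u, S v ≤ ∫ v in (0)..t, S v :=
        intervalIntegral.integral_mono_interval le_rfl hu.1 hu.2
          (Eventually.of_forall fun v => hS0 v) hmono.intervalIntegrable
      have h3 : (u - 0) ^ (1 - α) ≤ T ^ (1 - α) :=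
        Real.rpow_le_rpow (by linarith [hu.1]) (by linarith [hu.2, ht.2]) h1α.le
      calc ‖z u‖ = ‖z 0 + (z u - z 0)‖ := by rw [add_sub_cancel]
        _ ≤ ‖z 0‖ + ‖z u - z 0‖ := norm_add_le _ _
        _ ≤ a + (L₀ * (∫ u in (0)..t, S u) + θ * T ^ (1 - α)) :=
          add_le_add hz0' (h1.trans (add_le_add (mul_le_mul_of_nonneg_left h2 hL₀.le)
            (mul_le_mul_of_nonneg_left h3 hθ)))
    have hSt : S t ≤ (1 + d) * Z := by
      have hZ0 : 0 ≤ Z := ha.trans hZa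
      refine supUpTo_pathOf_le _ (by positivity) fun u hu hut => ?_
      rcases le_total u 0 with hu0 | hu0
      · have : 0 ≤ d * Z := by positivity
        linarith [hxa u ⟨hu.1, hu0⟩]
      · rw [h.eq_add hη hr ⟨hu0, hu.2⟩]
        refine (norm_add_le _ _).trans ?_
        have h1 := hzZ u ⟨hu0, hut⟩
        have h2 := norm_regulator_le hu0 fun v hv => hzZ v ⟨hv.1, hv.2.trans hut⟩
        linarith
    rw [hZ_def] at hSt
    linarith
  have hb := le_exp_of_le_add_integral (S := S) (a := (1 + d) * (a + θ * T ^ (1 - α)))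
    (c := (1 + d) * L₀) (τ := τ) (B := S τ) (by positivity) (by positivity)
    hmono.intervalIntegrable (fun t ht => hmono ht.2) hbound
  intro t ht
  refine (hb t ht).trans ?_
  unfold supConst
  have he : Real.exp (2 * ((1 + d) * L₀) * t) ≤ Real.exp (2 * ((1 + d) * L₀) * T) := by
    have := ht.2.trans hτT
    gcongr
  have hp : 0 ≤ T ^ (1 - α) := Real.rpow_nonneg hT _
  calc _ ≤ 2 * ((1 + d) * ((1 + T ^ (1 - α)) * (a + θ))) *
        Real.exp (2 * ((1 + d) * L₀) * T) := by
        have : a + θ * T ^ (1 - α) ≤ (1 + T ^ (1 - α)) * (a + θ) := by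
          have := mul_nonneg hp ha
          linarith
        gcongr
    _ = _ := by ring

/-- The growth constant for the norm of a solution. -/
noncomputable def normConst (d : ℕ) (α L₀ T : ℝ) : ℝ :=
  1 + supConst d α L₀ T + (1 + d) * (L₀ * supConst d α L₀ T * T ^ α + 1) *
    T ^ (1 - 2 * α) * (1 / (1 - 2 * α) + 1 / α)

/-- The supremum bound turns the drift increment into a Hölder one, so z, then its regulator, then x
are (1-α)-Hölder after time 0, which controls the fractional norm. -/
theorem IsSolution.normAlphaInf_le (hα0 : 0 < α) (hα : α < 1 / 2)
    (h : IsSolution α r T b σ g η x)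
    (hη : MemWPos α (-r) 0 η) (hr : 0 < r) {L₀ : ℝ} (hL₀ : 0 < L₀) (hτ0 : 0 ≤ τ) (hτT : τ ≤ T)
    (hθ : 0 ≤ θ)
    (hz : ∀ s t, 0 ≤ s → s ≤ t → t ≤ τ → ‖reflector α b σ g η x h.continuousOn t -
      reflector α b σ g η x h.continuousOn s‖ ≤
      L₀ * (∫ u in s..t, supUpTo (pathOf x h.continuousOn) u) + θ * (t - s) ^ (1 - α)) :
    normAlphaInf α (-r) τ x ≤
      ENNReal.ofReal (normConst d α L₀ T * ((normAlphaInf α (-r) 0 x).toReal + θ)) := by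
  have hS := h.norm_le (by linarith) hη hr hL₀ hτ0 hτT hθ hz
  set z := reflector α b σ g η x h.continuousOn with hz_def
  set S := supUpTo (pathOf x h.continuousOn) with hS_def
  set a := (normAlphaInf α (-r) 0 x).toReal with ha_def
  have ha : 0 ≤ a := ENNReal.toReal_nonneg
  have hT : 0 ≤ T := hτ0.trans hτT
  have h1α : 0 < 1 - α := by linarith
  have h12 : 0 < 1 - 2 * α := by linarith
  have hfin : normAlphaInf α (-r) 0 x < ∞ := (normAlphaInf_mono hT).trans_lt h.memW.norm_lt_top
  have hmono : Monotone S := monotone_supUpTo _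
  have hC : 0 ≤ supConst d α L₀ T := by unfold supConst; positivity
  set X := supConst d α L₀ T * (a + θ) with hX_def
  have hX : 0 ≤ X := by positivity
  set κ := L₀ * X * T ^ α + θ with hκ_def
  have hκ : 0 ≤ κ := by positivity
  have hzκ : ∀ s t, 0 ≤ s → s ≤ t → t ≤ τ → ‖z t - z s‖ ≤ κ * (t - s) ^ (1 - α) := by
    intro s t hs hst ht
    have hts : 0 ≤ t - s := sub_nonneg.2 hst
    have h1 : ∫ u in s..t, S u ≤ X * (t - s) := by
      have := intervalIntegral.integral_mono_on hst hmono.intervalIntegrable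
        (intervalIntegrable_const (c := X) (μ := volume)) fun u hu =>
          hS u ⟨hs.trans hu.1, hu.2.trans ht⟩
      rwa [intervalIntegral.integral_const, smul_eq_mul, mul_comm] at this
    have h2 : t - s ≤ T ^ α * (t - s) ^ (1 - α) := by
      rcases hts.eq_or_lt with h0 | h0
      · rw [← h0, Real.zero_rpow h1α.ne', mul_zero]
      · calc t - s = (t - s) ^ α * (t - s) ^ (1 - α) := by
              rw [← Real.rpow_add h0, add_sub_cancel, Real.rpow_one]
          _ ≤ _ := by
              gcongr
              linarith
    calc ‖z t - z s‖ ≤ L₀ * (∫ u in s..t, S u) + θ * (t - s) ^ (1 - α) := hz s t hs hst ht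
      _ ≤ L₀ * (X * (T ^ α * (t - s) ^ (1 - α))) + θ * (t - s) ^ (1 - α) := by
          have h3 := h1.trans (mul_le_mul_of_nonneg_left h2 hX)
          gcongr
      _ = κ * (t - s) ^ (1 - α) := by rw [hκ_def]; ring
  have hxX : ∀ u ∈ Icc 0 τ, ‖x u‖ ≤ X := fun u hu =>
    (norm_le_supUpTo_pathOf h.continuousOn ⟨by linarith [hu.1], hu.2.trans hτT⟩ le_rfl).trans
      (hS u hu)
  have hxκ : ∀ s t, 0 ≤ s → s ≤ t → t ≤ τ →
      ‖x t - x s‖ ≤ (1 + d) * κ * (t - s) ^ (1 - α) := by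
    intro s t hs hst ht
    rw [h.eq_add hη hr ⟨hs.trans hst, ht.trans hτT⟩,
      h.eq_add hη hr ⟨hs, hst.trans (ht.trans hτT)⟩, add_sub_add_comm]
    have hreg : ‖regulator z t - regulator z s‖ ≤ d * (κ * (t - s) ^ (1 - α)) := by
      refine norm_regulator_sub_le (Z := ‖z 0‖ + κ * T ^ (1 - α)) hs hst (fun u hu => ?_)
        fun u hu => ?_
      · have h1 := hzκ 0 u le_rfl hu.1 (hu.2.trans ht)
        have h3 : (u - 0) ^ (1 - α) ≤ T ^ (1 - α) :=
          Real.rpow_le_rpow (by linarith [hu.1]) (by linarith [hu.2]) h1α.le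
        calc ‖z u‖ = ‖z 0 + (z u - z 0)‖ := by rw [add_sub_cancel]
          _ ≤ ‖z 0‖ + ‖z u - z 0‖ := norm_add_le _ _
          _ ≤ _ := by
            have := h1.trans (mul_le_mul_of_nonneg_left h3 hκ)
            gcongr
      · refine (hzκ s u hs hu.1 (hu.2.trans ht)).trans (mul_le_mul_of_nonneg_left ?_ hκ)
        exact Real.rpow_le_rpow (by linarith [hu.1]) (by linarith [hu.2]) h1α.le
    have := hzκ s t hs hst ht
    calc _ ≤ ‖z t - z s‖ + ‖regulator z t - regulator z s‖ := norm_add_le _ _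
      _ ≤ _ := by linarith
  refine (normAlphaInf_le_of_holder hα0 hα hr hX (by positivity) hτ0 hfin hxX hxκ).trans
    (ENNReal.ofReal_le_ofReal ?_)
  have hτp : τ ^ (1 - 2 * α) ≤ T ^ (1 - 2 * α) := Real.rpow_le_rpow hτ0 hτT h12.le
  have hκle : κ ≤ (L₀ * supConst d α L₀ T * T ^ α + 1) * (a + θ) := by
    rw [hκ_def, hX_def]
    linarith
  calc _ ≤ (a + θ) + X + (1 + d) * ((L₀ * supConst d α L₀ T * T ^ α + 1) * (a + θ)) *
        T ^ (1 - 2 * α) * (1 / (1 - 2 * α) + 1 / α) := by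
        gcongr
        linarith
    _ = _ := by rw [hX_def]; unfold normConst; ring

/-- The constant bounding the Hölder coefficient of the reflector. -/
noncomputable def driverConst (d m : ℕ) (α β M₀ K₀ B₀ T : ℝ) : ℝ :=
  B₀ + d * m * (4 * K₀ / (1 - α) + M₀ * (T ^ (β - α) / (β - α) + 1) * T ^ α)

/-- The growth of the norm of a solution over a time interval not longer than the delay. -/
theorem IsSolution.normAlphaInf_step {τ' : ℝ} (hα0 : 0 < α) (hα : α < 1 / 2) (hβ : α < β)
    (hM : 0 ≤ M₀) (hK : 0 ≤ K₀) (hB₀ : 0 ≤ B₀) (hγ0 : 0 ≤ γ) (hγ : γ ≤ 1) (hr : 0 < r)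
    (h : IsSolution α r T b σ g η x) (h1 : H1 T β M₀ σ) (h2 : H2 r T (1 / α) b L b₀)
    (h3 : H3 T γ K₀ σ)
    (hb₀ : eLpNorm b₀ (ENNReal.ofReal (1 / α)) (volume.restrict (Ioc 0 T)) ≤ ENNReal.ofReal B₀)
    (hg : MemDriver α T g) (hη : MemWPos α (-r) 0 η) (hτ0 : 0 ≤ τ) (hττ' : τ ≤ τ')
    (hτ'r : τ' ≤ τ + r) (hτ'T : τ' ≤ T) :
    1 + (normAlphaInf α (-r) τ' x).toReal ≤
      (1 + normConst d α (L 0) T * (1 + driverConst d m α β M₀ K₀ B₀ T)) *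
        (1 + Lam α T g) * (1 + (normAlphaInf α (-r) τ x).toReal) := by
  have hfin : ∀ {u}, u ≤ T → normAlphaInf α (-r) u x < ∞ := fun hu =>
    (normAlphaInf_mono hu).trans_lt h.memW.norm_lt_top
  have hT : 0 ≤ T := hτ0.trans (hττ'.trans hτ'T)
  set a := (normAlphaInf α (-r) τ x).toReal with ha_def
  have ha : 0 ≤ a := ENNReal.toReal_nonneg
  have ha0 : (normAlphaInf α (-r) 0 x).toReal ≤ a :=
    ENNReal.toReal_mono (hfin (hττ'.trans hτ'T)).ne (normAlphaInf_mono hτ0)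
  have h1α : 0 < 1 - α := by linarith
  have h12 : 0 < 1 - 2 * α := by linarith
  have hβα : 0 < β - α := sub_pos.2 hβ
  have hΛ := Lam_nonneg (T := T) (g := g) (by linarith : α < 1)
  have hL := h2.const_pos 0 le_rfl
  set D := (d : ℝ) * m * (4 * K₀ / (1 - α) + M₀ * (T ^ (β - α) / (β - α) + 1) * T ^ α) with hD_def
  have hD : 0 ≤ D := by positivity
  -- The norm `a` runs only up to τ although θ governs increments up to τ'. This is where the delay
  -- breaks the circularity.
  set θ := B₀ + D * (Lam α T g * (1 + a)) with hθ_def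
  have hθ : 0 ≤ θ := by positivity
  have hz : ∀ s t, 0 ≤ s → s ≤ t → t ≤ τ' → ‖reflector α b σ g η x h.continuousOn t -
      reflector α b σ g η x h.continuousOn s‖ ≤
      L 0 * (∫ u in s..t, supUpTo (pathOf x h.continuousOn) u) + θ * (t - s) ^ (1 - α) := by
    intro s t hs hst ht
    have e1 := norm_integral_drift_sub_le (p := pathOf x h.continuousOn) hα0
      (by linarith) h2 hB₀ hb₀ hs hst (ht.trans hτ'T)
    have e2 := norm_stieltjesVec_sub_le hr hα0 (by linarith) hβ hM hK hγ0 hγ h1 h3 hg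
      h.continuousOn hτ'T hτ'r (hfin (hττ'.trans hτ'T)) hs hst ht
    have e3 : reflector α b σ g η x h.continuousOn t - reflector α b σ g η x h.continuousOn s =
        ((∫ u in (0)..t, b u (pathOf x h.continuousOn)) -
          ∫ u in (0)..s, b u (pathOf x h.continuousOn)) +
        (stieltjesVec α T (fun s => σ s (x (s - r))) g t -
          stieltjesVec α T (fun s => σ s (x (s - r))) g s) := by
      unfold reflector
      abel
    rw [e3]
    refine (norm_add_le _ _).trans ((add_le_add e1 e2).trans_eq ?_)
    rw [hθ_def]
    ring
  have hC : 0 ≤ normConst d α (L 0) T := by unfold normConst supConst; positivity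
  have hle := h.normAlphaInf_le hα0 hα hη hr hL (hτ0.trans hττ') hτ'T hθ hz
  have hle' := ENNReal.toReal_le_of_le_ofReal
    (mul_nonneg hC (add_nonneg ENNReal.toReal_nonneg hθ)) hle
  have hE : (normAlphaInf α (-r) 0 x).toReal + θ ≤
      (1 + driverConst d m α β M₀ K₀ B₀ T) * ((1 + Lam α T g) * (1 + a)) := by
    have e1 : driverConst d m α β M₀ K₀ B₀ T = B₀ + D := rfl
    have e2 : 0 ≤ Lam α T g * (1 + a) := by positivity
    have e3 : 0 ≤ B₀ * (a + Lam α T g * (1 + a)) := by positivity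
    have e4 : 0 ≤ D * (1 + a) := by positivity
    rw [e1, hθ_def]
    linarith
  have hE1 : 1 ≤ (1 + Lam α T g) * (1 + a) := by
    have e2 : 0 ≤ Lam α T g * (1 + a) := by positivity
    linarith
  have := hle'.trans (mul_le_mul_of_nonneg_left hE hC)
  linarith

theorem IsSolution.normAlphaInf_iterate (hα0 : 0 < α) (hα : α < 1 / 2) (hβ : α < β)
    (hM : 0 ≤ M₀) (hK : 0 ≤ K₀) (hB₀ : 0 ≤ B₀) (hγ0 : 0 ≤ γ) (hγ : γ ≤ 1) (hr : 0 < r) (hT : 0 ≤ T)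
    (h : IsSolution α r T b σ g η x) (h1 : H1 T β M₀ σ) (h2 : H2 r T (1 / α) b L b₀)
    (h3 : H3 T γ K₀ σ)
    (hb₀ : eLpNorm b₀ (ENNReal.ofReal (1 / α)) (volume.restrict (Ioc 0 T)) ≤ ENNReal.ofReal B₀)
    (hg : MemDriver α T g) (hη : MemWPos α (-r) 0 η) (k : ℕ) :
    1 + (normAlphaInf α (-r) (min (k * r) T) x).toReal ≤
      ((1 + normConst d α (L 0) T * (1 + driverConst d m α β M₀ K₀ B₀ T)) *
        (1 + Lam α T g)) ^ k * (1 + (normAlphaInf α (-r) 0 x).toReal) := by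
  induction k with
  | zero => simp [hT]
  | succ k ih =>
    have hstep := h.normAlphaInf_step (τ := min (k * r) T) (τ' := min ((k + 1 : ℕ) * r) T) hα0 hα hβ
      hM hK hB₀ hγ0 hγ hr h1 h2 h3 hb₀ hg hη (by positivity)
      (min_le_min_right _ (by push_cast; linarith))
      (by
        rw [← min_add_add_right]
        exact min_le_min (by push_cast; linarith) (by linarith)) (min_le_right _ _)
    have hβα : 0 < β - α := sub_pos.2 hβ
    have h1α : 0 < 1 - α := by linarith
    have h12 : 0 < 1 - 2 * α := by linarith
    have hL := h2.const_pos 0 le_rfl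
    have hΛ := Lam_nonneg (T := T) (g := g) (by linarith : α < 1)
    refine hstep.trans ((mul_le_mul_of_nonneg_left ih ?_).trans_eq ?_)
    · unfold normConst supConst driverConst
      positivity
    · ring

/-! ### Polynomial growth in Λ absorbed by the exponential. -/

theorem IsExponent.one_le_inv {φ : ℝ} (hα0 : 0 < α) (hα : α < 1 / 2) (h : IsExponent α γ φ) :
    1 ≤ 1 / (1 - φ) := by
  have h1 := h.mem.1
  have h2 := h.mem.2
  rw [le_div_iff₀ (by linarith)]
  linarith

/-- Uses x^N / N! ≤ e^x at x = T (1 + Λ), then Λ ≤ 1 + Λ^p. The numbers 2 and 1 become d₁ and d₂. -/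
theorem one_add_pow_le_exp {Λ p : ℝ} (hT : 0 < T) (hΛ : 0 ≤ Λ) (hp : 1 ≤ p) (N : ℕ) :
    (1 + Λ) ^ N ≤ N.factorial / T ^ N * Real.exp (T * (2 + 1 * Λ ^ p)) := by
  have h1 : Λ ≤ 1 + Λ ^ p := by
    rcases le_total Λ 1 with h | h
    · linarith [Real.rpow_nonneg hΛ p]
    · calc Λ = Λ ^ (1 : ℝ) := (Real.rpow_one Λ).symm
        _ ≤ Λ ^ p := Real.rpow_le_rpow_of_exponent_le h hp
        _ ≤ _ := by linarith
  have h2 := Real.pow_div_factorial_le_exp (T * (1 + Λ)) (by positivity) N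
  rw [div_le_iff₀ (by positivity), mul_pow] at h2
  have h3 : Real.exp (T * (1 + Λ)) ≤ Real.exp (T * (2 + 1 * Λ ^ p)) :=
    Real.exp_le_exp.2 (mul_le_mul_of_nonneg_left (by linarith) hT.le)
  rw [div_mul_eq_mul_div, le_div_iff₀ (by positivity)]
  calc (1 + Λ) ^ N * T ^ N ≤ Real.exp (T * (1 + Λ)) * N.factorial := by linarith
    _ ≤ _ := by rw [mul_comm]; gcongr

end Solution

end DelayReflection

theorem mainTheorem4 (d m : ℕ) (r T α : ℝ) (hr : 0 < r) (hT : 0 < T)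
    (hα : 0 < α) (hα' : α < 1 / 2)
    (M₀ K₀ L₀ B₀ : ℝ) (hM₀ : 0 < M₀) (hK₀ : 0 < K₀) (hL₀ : 0 < L₀) (hB₀ : 0 ≤ B₀) :
    ∃ d₁ d₂ : ℝ, 0 < d₁ ∧ 0 < d₂ ∧
      ∀ β γ φ : ℝ, α < β → 0 ≤ γ → γ ≤ 1 → IsExponent α γ φ →
      ∃ d₃ : ℝ, 0 < d₃ ∧
        ∀ (σ : ℝ → Eu d → Mat d m) (b : ℝ → CPath d r T → Eu d) (L b₀ : ℝ → ℝ),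
          H1 T β M₀ σ → H2 r T (1 / α) b L b₀ → H3 T γ K₀ σ →
          L 0 = L₀ →
          MeasureTheory.eLpNorm b₀ (ENNReal.ofReal (1 / α))
            (MeasureTheory.volume.restrict (Set.Ioc 0 T)) ≤ ENNReal.ofReal B₀ →
        ∀ (g : ℝ → Eu m) (η x : ℝ → Eu d),
          MemDriver α T g → MemWPos α (-r) 0 η → IsSolution α r T b σ g η x →
          normAlphaInf α (-r) T x ≤ ENNReal.ofReal
            (d₃ * ((normAlphaInf α (-r) 0 η).toReal + Lam α T g + 1) *
              Real.exp (T * (d₁ + d₂ * Lam α T g ^ (1 / (1 - φ))))) := by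
  refine ⟨2, 1, two_pos, one_pos, fun β γ φ hβ hγ0 hγ hφ => ?_⟩
  have hβα : 0 < β - α := sub_pos.2 hβ
  have h1α : 0 < 1 - α := by linarith
  have h12 : 0 < 1 - 2 * α := by linarith
  set C := 1 + normConst d α L₀ T * (1 + driverConst d m α β M₀ K₀ B₀ T) with hC_def
  have hC : 0 < C := by
    rw [hC_def]
    unfold normConst supConst driverConst
    positivity
  -- The number of delay windows needed to cover [0, T].
  set N := ⌈T / r⌉₊ with hN
  refine ⟨C ^ N * (N.factorial / T ^ N), by positivity, ?_⟩
  intro σ b L b₀ h1 h2 h3 hL hb₀ g η x hg hη hx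
  have hiter := hx.normAlphaInf_iterate hα hα' hβ hM₀.le hK₀.le hB₀ hγ0 hγ hr hT.le h1 h2 h3 hb₀ hg
    hη N
  have hNT : min (N * r) T = T := min_eq_right ((div_le_iff₀ hr).1 (Nat.le_ceil _))
  -- For u ≤ 0 the modulus integral only looks back into [-r, 0], where x and η coincide.
  have hη0 : normAlphaInf α (-r) 0 x = normAlphaInf α (-r) 0 η := by
    refine biSup_congr fun u hu => ?_
    rw [hx.initial u hu]
    congr 1
    refine MeasureTheory.setLIntegral_congr_fun measurableSet_Ioo fun v hv => ?_
    rw [hx.initial v ⟨hv.1.le, hv.2.le.trans hu.2⟩]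
  rw [hNT, hη0, hL, ← hC_def, mul_pow] at hiter
  have hΛ := Lam_nonneg (T := T) (g := g) (by linarith : α < 1)
  have hexp := one_add_pow_le_exp hT hΛ (hφ.one_le_inv hα hα') N
  set e := (normAlphaInf α (-r) 0 η).toReal with he_def
  have he : 0 ≤ e := ENNReal.toReal_nonneg
  rw [← ENNReal.ofReal_toReal hx.memW.norm_lt_top.ne]
  refine ENNReal.ofReal_le_ofReal ?_
  calc (normAlphaInf α (-r) T x).toReal
      ≤ C ^ N * (1 + Lam α T g) ^ N * (1 + e) := by linarith
    _ ≤ C ^ N * (N.factorial / T ^ N * Real.exp (T * (2 + 1 * Lam α T g ^ (1 / (1 - φ))))) *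
          (e + Lam α T g + 1) := by
        have : 1 + e ≤ e + Lam α T g + 1 := by linarith
        gcongr
    _ = _ := by ring
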